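/- Let $T=[-\pi,\pi)$ (regarded as a circle), $f\in L^1(T)$ complex valued, $\|f\|_1=\int_T|f|$, $\hat f(k)=\frac1{2\pi}\int_T f(t)e^{-\imath kt}\,dt$, $S_nf(y)=\sum_{k=-n}^n\hat f(k)e^{\imath ky}$, $\sigma_nf=\frac1{n+1}\sum_{k=0}^nS_kf$ for $n\ge 0$, and $V_nf=\frac1n\sum_{j=n}^{2n-1}S_jf$ for $n\ge 1$. The dyadic intervals are the intervals $[-\pi+2\pi k/2^n,\,-\pi+2\pi(k+1)/2^n)$ with $n\ge 0$, $0\le k<2^n$. For $\lambda>\|f\|_1/(2\pi)$ let $\mathcal F$ be the set of the dyadic intervals $I$ with $|I|^{-1}\int_I|f|>\lambda$ and $|J|^{-1}\int_J|f|\le\lambda$ for every dyadic interval $J\supsetneq I$. For an odd natural number $\beta$ and a dyadic interval $I$ let $\beta I=\bigcup_{|i|\le(\beta-1)/2}(I+i|I|)$ (translations modulo $2\pi$, so that $\beta I\subset T$), and for $\epsilon>0$ let $\beta F_\epsilon=\bigcup_{I\in\mathcal F,\ |I|>\epsilon}\beta I$. Write $1_{\overline{\beta F_\epsilon}}$ for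 the characteristic function of $T\setminus\beta F_\epsilon$. Let $0<\delta<1/2$ and let $(n_i)_{i\ge1}$ be a strictly increasing sequence of positive integers; put $m_i=\lfloor n_i/10\rfloor$. For $N\ge1$ let $K=\lfloor\sqrt N\rfloor$ and $K_0=\lfloor K^{2\delta}\rfloor$. Each $1\le i\le N$ is written uniquely as $i=(j-1)K_0+b$ with $j\ge1$ and $0\le b<K_0$; put $\beta_i'=20(j+1)\log^2(j+1)/n_i$ (which depends on $N$ through $j$). Set \[ T_Nf=\frac1N\sum_{i=1}^N\left(S_{n_i}f-V_{n_i}f\right),\qquad T_{N,\beta}f=\frac1N\sum_{i=1}^N\left(S_{n_i}f-V_{n_i}f\right)\left(\sigma_{m_i}1_{\overline{\beta F_{\beta_i'}}}\right). \] Lemma (replacement). For every odd integer $\beta>7$ there is a constant $C_\beta>0$, depending only on $\beta$, such that for all $0<\delta<1/2$, all $f\in L^1(T)$, all $\lambda>\|f\|_1/(2\pi)$ and all strictly increasing sequences $(n_i)$ of positive integers, \[ \operatorname{mes}\Bigl\{y\in T:\ \sup_{N\ge1}|T_{N,\beta}f(y)-T_Nf(y)|>\lambda/2\Bigr\}\le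 C_\beta\,\frac1{1-2\delta}\sqrt{\frac{\|f\|_1}{\lambda}} . \] -/

import Mathlib

open MeasureTheory Set

noncomputable section

namespace FourierMeans

/-- The torus `T = [-π, π)`, as a subset of the line. A function on `T` is a function `ℝ → ℂ`
of which only the values on `T` are used. -/
def torus : Set ℝ := Ico (-Real.pi) Real.pi

/-- `‖f‖₁ = ∫_T |f|`. -/
def normL1 (f : ℝ → ℂ) : ℝ := ∫ x in torus, ‖f x‖

/-- The `k`-th Fourier coefficient `(1 / 2π) ∫_T f(t) e^{-ikt} dt`. -/
def coeff (f : ℝ → ℂ) (k : ℤ) : ℂ :=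
  (1 / (2 * (Real.pi : ℂ))) * ∫ t in torus, f t * Complex.exp (-(Complex.I * k * t))

/-- `coeff` is Mathlib's Fourier coefficient of a function on the interval from `-π` to `π`. -/
theorem coeff_eq_fourierCoeffOn (f : ℝ → ℂ) (k : ℤ) (h : -Real.pi < Real.pi) :
    coeff f k = fourierCoeffOn h f k := by
  rw [fourierCoeffOn_eq_integral, intervalIntegral.integral_of_le h.le,
    integral_Ioc_eq_integral_Ioo, coeff, torus, integral_Ico_eq_integral_Ioo]
  have h2 : Real.pi - -Real.pi = 2 * Real.pi := by ring
  have hp : (Real.pi : ℂ) ≠ 0 := by exact_mod_cast Real.pi_ne_zero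
  rw [Complex.real_smul]
  congr 1
  · rw [h2]; push_cast; ring
  · congr 1
    funext t
    rw [fourier_coe_apply, smul_eq_mul, mul_comm]
    congr 2
    push_cast
    field_simp
    ring

/-- The partial sum `S_n f`. -/
def partialSum (n : ℕ) (f : ℝ → ℂ) (y : ℝ) : ℂ :=
  ∑ k ∈ Finset.Icc (-(n : ℤ)) (n : ℤ), coeff f k * Complex.exp (Complex.I * k * y)

/-- The Fejér mean `σ_n f`. -/
def fejer (n : ℕ) (f : ℝ → ℂ) (y : ℝ) : ℂ :=
  (1 / ((n : ℂ) + 1)) * ∑ k ∈ Finset.range (n + 1), partialSum k f y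

/-- The de la Vallée-Poussin mean `V_n f` (for `n ≥ 1`). -/
def valleePoussin (n : ℕ) (f : ℝ → ℂ) (y : ℝ) : ℂ :=
  (1 / (n : ℂ)) * ∑ j ∈ Finset.Ico n (2 * n), partialSum j f y

/-- The dyadic subintervals of `T`. -/
def dyadicIntervals : Set (Set ℝ) :=
  {I | ∃ n k : ℕ, k < 2 ^ n ∧
    I = Ico (-Real.pi + 2 * Real.pi * k / 2 ^ n) (-Real.pi + 2 * Real.pi * (k + 1) / 2 ^ n)}

/-- The mean value `|I|⁻¹ ∫_I |f|`. -/
def meanAbs (f : ℝ → ℂ) (I : Set ℝ) : ℝ := (volume.real I)⁻¹ * ∫ x in I, ‖f x‖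

/-- The Calderón–Zygmund family of `f` at height `lam`: the maximal dyadic intervals on which
the mean value of `|f|` exceeds `lam`. -/
def czFamily (f : ℝ → ℂ) (lam : ℝ) : Set (Set ℝ) :=
  {I | I ∈ dyadicIntervals ∧ lam < meanAbs f I ∧
    ∀ J ∈ dyadicIntervals, I ⊂ J → meanAbs f J ≤ lam}

/-- The `i`-th neighbour `I + |I| i` of `I`, the addition being modulo `T`. -/
def neighbour (I : Set ℝ) (i : ℤ) : Set ℝ :=
  {x | x ∈ torus ∧ ∃ t ∈ I, ∃ k : ℤ, x = t + volume.real I * i + 2 * Real.pi * k}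

/-- `γ I` for an odd natural number `γ`: the union of the neighbours `I^{(i)}` of `I` with
`|i| ≤ (γ - 1) / 2`. -/
def dilate (γ : ℕ) (I : Set ℝ) : Set ℝ :=
  ⋃ (i : ℤ) (_ : 2 * |i| + 1 ≤ (γ : ℤ)), neighbour I i

/-- `γ F_ε`: the union of the `γ I` over the intervals `I` of the Calderón–Zygmund family
with `|I| > ε`. -/
def dilatedUnion (γ : ℕ) (f : ℝ → ℂ) (lam ε : ℝ) : Set ℝ :=
  ⋃ I ∈ {I | I ∈ czFamily f lam ∧ ε < volume.real I}, dilate γ I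

/-- `K₀ = ⌊K^{2δ}⌋` with `K = ⌊√N⌋`. -/
def blockLength (δ : ℝ) (N : ℕ) : ℕ := ⌊((Nat.sqrt N : ℕ) : ℝ) ^ (2 * δ)⌋₊

/-- The `j ≥ 1` in the representation `i = (j - 1) K₀ + b`, `0 ≤ b < K₀`. -/
def blockIndex (δ : ℝ) (N i : ℕ) : ℕ := i / blockLength δ N + 1

/-- `blockIndex` is the number described in its doc-string. -/
theorem blockIndex_spec (δ : ℝ) (hδ : 0 < δ) (N i : ℕ) (hN : 1 ≤ N) (j b : ℕ) (hj : 1 ≤ j) :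
    (i = (j - 1) * blockLength δ N + b ∧ b < blockLength δ N) ↔
      (j = blockIndex δ N i ∧ b = i % blockLength δ N) := by
  have hK : 1 ≤ Nat.sqrt N := Nat.le_sqrt.2 (by simpa using hN)
  have hpos : 0 < blockLength δ N := by
    refine Nat.floor_pos.2 (Real.one_le_rpow (by exact_mod_cast hK) (by positivity))
  unfold blockIndex
  generalize blockLength δ N = L at hpos
  obtain ⟨j, rfl⟩ : ∃ a, j = a + 1 := ⟨j - 1, by omega⟩
  simp only [Nat.add_sub_cancel, Nat.add_right_cancel_iff]
  constructor
  · rintro ⟨rfl, hb⟩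
    refine ⟨?_, ?_⟩
    · rw [mul_comm, Nat.mul_add_div hpos, Nat.div_eq_of_lt hb, add_zero]
    · rw [mul_comm, Nat.mul_add_mod, Nat.mod_eq_of_lt hb]
  · rintro ⟨rfl, rfl⟩
    exact ⟨(Nat.div_add_mod' i L).symm, Nat.mod_lt _ hpos⟩

/-- `β'_i = 20 (j + 1) log² (j + 1) / n_i`; it depends on `N` through `j`. -/
def threshold (n : ℕ → ℕ) (δ : ℝ) (N i : ℕ) : ℝ :=
  20 * ((blockIndex δ N i : ℝ) + 1) * Real.log ((blockIndex δ N i : ℝ) + 1) ^ 2 / (n i : ℝ)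

/-- The factor `σ_{m_i} 1_{T \ βF_{β'_i}}` with `m_i = ⌊n_i / 10⌋`. -/
def cutoff (n : ℕ → ℕ) (δ : ℝ) (β : ℕ) (f : ℝ → ℂ) (lam : ℝ) (N i : ℕ) : ℝ → ℂ :=
  fejer (n i / 10)
    (indicator (torus \ dilatedUnion β f lam (threshold n δ N i)) (fun _ => (1 : ℂ)))

/-- `T_N f = (1 / N) ∑_{i=1}^N (S_{n_i} f - V_{n_i} f)`. -/
def average (n : ℕ → ℕ) (f : ℝ → ℂ) (N : ℕ) (y : ℝ) : ℂ :=
  (1 / (N : ℂ)) * ∑ i ∈ Finset.Icc 1 N, (partialSum (n i) f y - valleePoussin (n i) f y)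

/-- `T_{N,β} f = (1 / N) ∑_{i=1}^N (S_{n_i} f - V_{n_i} f) σ_{m_i} 1_{T \ βF_{β'_i}}`. -/
def modifiedAverage (n : ℕ → ℕ) (δ : ℝ) (β : ℕ) (f : ℝ → ℂ) (lam : ℝ) (N : ℕ) (y : ℝ) : ℂ :=
  (1 / (N : ℂ)) * ∑ i ∈ Finset.Icc 1 N,
    (partialSum (n i) f y - valleePoussin (n i) f y) * cutoff n δ β f lam N i y

end FourierMeans

end

noncomputable section

namespace FourierMeans

open Complex Filter Topology

/-! Away from a small exceptional set the cutoff factors are so close to `1` that the supremum over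
`N` is dominated by one series not depending on `N`; Kolmogorov's inequality then bounds that
series.

The exceptional set is the union of all `(β + 2) I` over the Calderón–Zygmund family; its measure is
at most a constant, depending on `β`, times `‖f‖₁ / λ`. A point `y` outside it has distance at least
`ε` from `β F_ε` for every `ε > 0`. The Fejér kernel of order `m` has mass `O(1 / (m ε))` beyond
that distance, so with `m = m_i` and `ε = β'_i` the cutoff differs from `1` by at most `128 / (j +
1)`. Since `δ < 1/2` gives `K₀ ≤ √N`, and `i ≤ K₀ j`, this is at most `128 √N / i`. After division
by `N ≥ i` the coefficient of `|S_{n_i} f - V_{n_i} f|` is at most `128 i^{-3/2}`, uniformly in `N`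
(`enorm_modifiedAverage_sub_average_le`).

Raise the series to the power `p = 3/4`. By subadditivity of `x ^ p` the weights become a multiple
of `i^{-9/8}`, still summable, while the differences `S_n - V_n` map `L¹` to `L^p` uniformly in `n`
(`exists_lintegral_partialSum_sub_valleePoussin_le`). Chebyshev's inequality gives a bound of order
`(‖f‖₁ / λ)^{3/4}`. As `‖f‖₁ / λ < 2π`, both this and the measure of the exceptional set are bounded
by a multiple of the square root.

Kolmogorov's inequality is proved by complex analysis: the Cauchy integral `F` of a nonnegative
function has positive real part in the disc, so `F ^ p` is holomorphic there, its real part controls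
`|F| ^ p`, and the mean value property evaluates the average. -/

theorem measurableSet_torus : MeasurableSet torus := measurableSet_Ico

instance isFiniteMeasure_torus : IsFiniteMeasure (volume.restrict torus) := by
  unfold torus; infer_instance

/-! ### Cauchy integrals in the disc and Kolmogorov's inequality for them -/

theorem norm_exp_neg_I_mul (t : ℝ) : ‖exp (-(I * t))‖ = 1 := by
  rw [norm_exp]; simp

theorem norm_exp_I_mul_int_mul (k : ℤ) (t : ℝ) : ‖exp (I * k * t)‖ = 1 := by
  rw [norm_exp]; simp

theorem norm_exp_neg_I_mul_int_mul (k : ℤ) (t : ℝ) : ‖exp (-(I * k * t))‖ = 1 := by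
  rw [norm_exp]; simp

/-- The Cauchy integral `(1 / 2π) ∫_T f(t) / (1 - z e^{-it}) dt`. -/
def cauchy (f : ℝ → ℂ) (z : ℂ) : ℂ :=
  (1 / (2 * (Real.pi : ℂ))) * ∫ t in torus, f t * (1 - z * exp (-(I * t)))⁻¹

theorem integrable_mul_of_norm_le_one {f g : ℝ → ℂ} (hf : IntegrableOn f torus) (hg : Continuous g)
    (hg1 : ∀ t, ‖g t‖ ≤ 1) : IntegrableOn (fun t => f t * g t) torus :=
  Integrable.mul_bdd (c := 1) hf hg.aestronglyMeasurable (Eventually.of_forall hg1)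

theorem normL1_nonneg (f : ℝ → ℂ) : 0 ≤ normL1 f := integral_nonneg fun _ => norm_nonneg _

theorem norm_coeff_le (f : ℝ → ℂ) (k : ℤ) : ‖coeff f k‖ ≤ normL1 f / (2 * Real.pi) := by
  rw [coeff, normL1, norm_mul, div_eq_inv_mul (∫ x in torus, ‖f x‖)]
  have h : ‖(1 / (2 * (Real.pi : ℂ)))‖ = (2 * Real.pi)⁻¹ := by
    simp [abs_of_pos Real.pi_pos]
  rw [h]
  gcongr
  refine (norm_integral_le_integral_norm _).trans_eq ?_
  simp only [norm_mul, norm_exp_neg_I_mul_int_mul, mul_one]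

/-- Termwise integration of the geometric series of the kernel; only frequencies `k ≥ 0` occur. -/
theorem hasSum_cauchy {f : ℝ → ℂ} (hf : IntegrableOn f torus) {z : ℂ} (hz : ‖z‖ < 1) :
    HasSum (fun k : ℕ => coeff f k * z ^ k) (cauchy f z) := by
  have key := hasSum_integral_of_summable_integral_norm (μ := volume.restrict torus)
    (F := fun (k : ℕ) t => f t * (z * exp (-(I * t))) ^ k) (fun k => ?_) ?_
  · have h2 := key.mul_left (1 / (2 * (Real.pi : ℂ)))
    have e1 : (fun k : ℕ => coeff f k * z ^ k) = fun k => 1 / (2 * (Real.pi : ℂ)) *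
        ∫ t in torus, f t * (z * exp (-(I * t))) ^ k := by
      funext k
      rw [coeff, mul_assoc, ← integral_mul_const]
      congr 2
      funext t
      rw [mul_pow, ← exp_nat_mul, mul_assoc, mul_comm (z ^ k)]
      congr 3
      push_cast; ring
    have e2 : cauchy f z = 1 / (2 * (Real.pi : ℂ)) *
        ∫ t in torus, ∑' k : ℕ, f t * (z * exp (-(I * t))) ^ k := by
      rw [cauchy]
      congr 2
      funext t
      rw [tsum_mul_left, tsum_geometric_of_norm_lt_one]
      rwa [norm_mul, norm_exp_neg_I_mul, mul_one]
    rw [e1, e2]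
    exact h2
  · refine integrable_mul_of_norm_le_one hf (by fun_prop) fun t => ?_
    rw [norm_pow, norm_mul, norm_exp_neg_I_mul, mul_one]
    exact pow_le_one₀ (norm_nonneg _) hz.le
  · simp only [norm_mul, norm_pow, norm_exp_neg_I_mul, mul_one, integral_mul_const]
    exact (summable_geometric_of_lt_one (norm_nonneg _) hz).mul_left _

theorem differentiableOn_cauchy {f : ℝ → ℂ} (hf : IntegrableOn f torus) {R : ℝ} (hR0 : 0 ≤ R)
    (hR : R < 1) :
    DifferentiableOn ℂ (cauchy f) (Metric.ball 0 R) := by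
  have h := differentiableOn_tsum_of_summable_norm (U := Metric.ball (0 : ℂ) R)
    (F := fun (k : ℕ) (z : ℂ) => coeff f k * z ^ k)
    (u := fun k => normL1 f / (2 * Real.pi) * R ^ k)
    ((summable_geometric_of_lt_one hR0 hR).mul_left _) (fun k => by fun_prop) Metric.isOpen_ball
    (fun k w hw => ?_)
  · refine h.congr fun z hz => ?_
    rw [mem_ball_zero_iff] at hz
    exact (hasSum_cauchy hf (hz.trans hR)).tsum_eq.symm
  · rw [mem_ball_zero_iff] at hw
    rw [norm_mul, norm_pow]
    have := norm_coeff_le f k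
    have := (norm_nonneg _).trans this
    gcongr

/-- The map `w ↦ 1 / (1 - w)` sends the unit disc to the half plane `Re > 1/2`. This is what makes
Cauchy integrals of nonnegative functions avoid the branch cut of the power. -/
theorem half_le_re_inv_one_sub {w : ℂ} (hw : ‖w‖ < 1) : 1 / 2 ≤ ((1 - w)⁻¹).re := by
  have h1 : 1 - w ≠ 0 := by
    intro h
    rw [sub_eq_zero] at h
    simp [← h] at hw
  rw [inv_re, div_le_div_iff₀ two_pos (normSq_pos.2 h1)]
  have h2 : normSq w < 1 := by
    rw [normSq_eq_norm_sq]; exact pow_lt_one₀ (norm_nonneg _) hw two_ne_zero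
  rw [normSq_apply] at *
  simp only [sub_re, one_re, sub_im, one_im]
  nlinarith

theorem integrable_mul_cauchyKernel {f : ℝ → ℂ} (hf : IntegrableOn f torus) {z : ℂ}
    (hz : ‖z‖ < 1) : IntegrableOn (fun t => f t * (1 - z * exp (-(I * t)))⁻¹) torus := by
  have hn : ∀ t : ℝ, ‖z * exp (-(I * t))‖ = ‖z‖ := fun t => by
    rw [norm_mul, norm_exp_neg_I_mul, mul_one]
  have h0 : ∀ t : ℝ, 1 - ‖z‖ ≤ ‖1 - z * exp (-(I * t))‖ := fun t => by
    have := norm_sub_norm_le 1 (z * exp (-(I * t)))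
    rwa [hn, norm_one] at this
  refine Integrable.mul_bdd (c := (1 - ‖z‖)⁻¹) hf ?_ (Eventually.of_forall fun t => ?_)
  · refine (Continuous.inv₀ (by fun_prop) fun t h => ?_).aestronglyMeasurable
    have := h0 t
    rw [h, norm_zero] at this
    linarith
  · rw [norm_inv]
    exact inv_anti₀ (by linarith) (h0 t)

theorem re_cauchy_ofReal {u : ℝ → ℝ} (hu : IntegrableOn u torus) {z : ℂ}
    (hz : ‖z‖ < 1) : (cauchy (fun t => (u t : ℂ)) z).re =
      (1 / (2 * Real.pi)) * ∫ t in torus, u t * ((1 - z * exp (-(I * t)))⁻¹).re := by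
  have h1 : (1 / (2 * (Real.pi : ℂ))) = ((1 / (2 * Real.pi) : ℝ) : ℂ) := by push_cast; rfl
  rw [cauchy, h1, re_ofReal_mul]
  congr 1
  have hI : IntegrableOn (fun t => (u t : ℂ)) torus := hu.ofReal
  have := integral_re (𝕜 := ℂ) (integrable_mul_cauchyKernel hI hz)
  simp only [RCLike.re_to_complex] at this
  rw [← this]
  simp only [re_ofReal_mul]

theorem le_re_cauchy {u : ℝ → ℝ} (hu : IntegrableOn u torus) (h0 : ∀ t, 0 ≤ u t) {z : ℂ}
    (hz : ‖z‖ < 1) :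
    normL1 (fun t => (u t : ℂ)) / (4 * Real.pi) ≤ (cauchy (fun t => (u t : ℂ)) z).re := by
  rw [re_cauchy_ofReal hu hz]
  have h : normL1 (fun t => (u t : ℂ)) / (4 * Real.pi) =
      (1 / (2 * Real.pi)) * ∫ t in torus, u t * (1 / 2) := by
    rw [normL1, integral_mul_const]
    simp only [norm_real, Real.norm_of_nonneg (h0 _)]
    field_simp
    ring
  rw [h]
  refine mul_le_mul_of_nonneg_left ?_ (by positivity)
  have hI : IntegrableOn (fun t => (u t : ℂ)) torus := hu.ofReal
  refine integral_mono (hu.mul_const _) ?_ fun t => ?_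
  · have := (integrable_mul_cauchyKernel hI hz).re
    simpa only [RCLike.re_to_complex, re_ofReal_mul] using this
  · refine mul_le_mul_of_nonneg_left (half_le_re_inv_one_sub ?_) (h0 t)
    rwa [norm_mul, norm_exp_neg_I_mul, mul_one]

theorem cauchy_zero (f : ℝ → ℂ) : cauchy f 0 = coeff f 0 := by
  simp [cauchy, coeff]

/-- In the right half plane the real part of `w ^ p` controls `|w| ^ p`. -/
theorem cos_mul_norm_rpow_le_re_cpow {p : ℝ} (hp0 : 0 ≤ p) (hp1 : p ≤ 1) {w : ℂ} (hw : 0 < w.re) :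
    Real.cos (p * (Real.pi / 2)) * ‖w‖ ^ p ≤ (w ^ (p : ℂ)).re := by
  have hw0 : w ≠ 0 := by rintro rfl; simp at hw
  have harg : |w.arg| ≤ Real.pi / 2 := abs_arg_le_pi_div_two_iff.2 hw.le
  have : (w ^ (p : ℂ)).re = ‖w‖ ^ p * Real.cos (p * w.arg) := by
    rw [cpow_def_of_ne_zero hw0, exp_re, Real.rpow_def_of_pos (norm_pos_iff.2 hw0)]
    simp [log_re, log_im, mul_comm]
  rw [this, mul_comm]
  gcongr
  rw [← Real.cos_abs (p * w.arg), abs_mul, abs_of_nonneg hp0]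
  apply Real.cos_le_cos_of_nonneg_of_le_pi
  · positivity
  · nlinarith [Real.pi_pos]
  · gcongr

theorem lintegral_torus_circleMap (g : ℂ → ℝ) (r : ℝ) (hg : ∀ z, 0 ≤ g z)
    (hc : Continuous fun t => g (circleMap 0 r t)) :
    ∫⁻ t in torus, ENNReal.ofReal (g (circleMap 0 r t)) =
      ENNReal.ofReal (2 * Real.pi * Real.circleAverage g 0 r) := by
  have hpi := Real.pi_pos
  rw [← ofReal_integral_eq_lintegral_ofReal _ (Eventually.of_forall fun t => hg _)]
  · rw [Real.circleAverage_def, smul_eq_mul, ← mul_assoc, mul_inv_cancel₀ (by positivity), one_mul,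
      torus, integral_Ico_eq_integral_Ioc, ← intervalIntegral.integral_of_le (by linarith)]
    have hp : Function.Periodic (fun t => g (circleMap 0 r t)) (2 * Real.pi) := fun t => by
      simp only [periodic_circleMap 0 r t]
    have := hp.intervalIntegral_add_eq (-Real.pi) 0
    rw [show -Real.pi + 2 * Real.pi = Real.pi by ring, zero_add] at this
    rw [this]
  · exact hc.continuousOn.integrableOn_Icc.mono_set Ico_subset_Icc_self

/-- The mean value property for `F ^ p` gives `cos(pπ/2)` times the average of `|F| ^ p` at most `Re
(F(0) ^ p) ≤ |F(0)| ^ p`, and `F(0)` is the mean of `u`. The bound does not depend on `r`. -/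
theorem kolmogorov_nonneg {p : ℝ} (hp0 : 0 < p) (hp1 : p < 1) {u : ℝ → ℝ}
    (hu : IntegrableOn u torus) (h0 : ∀ t, 0 ≤ u t) {r : ℝ} (hr0 : 0 ≤ r) (hr : r < 1) :
    ∫⁻ t in torus, ‖cauchy (fun t => (u t : ℂ)) (circleMap 0 r t)‖ₑ ^ p ≤
      ENNReal.ofReal (2 * Real.pi / Real.cos (p * (Real.pi / 2)) *
        normL1 (fun t => (u t : ℂ)) ^ p) := by
  have hpi := Real.pi_pos
  set F := cauchy (fun t => (u t : ℂ)) with hF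
  have hI : IntegrableOn (fun t => (u t : ℂ)) torus := hu.ofReal
  have hcos : 0 < Real.cos (p * (Real.pi / 2)) :=
    Real.cos_pos_of_mem_Ioo ⟨by nlinarith, by nlinarith⟩
  have hmem : ∀ t, ‖circleMap 0 r t‖ < 1 := fun t => by
    rwa [norm_circleMap_zero, abs_of_nonneg hr0]
  -- If `u` has norm zero then `F = 0` and the strict positivity of `Re F` fails; this case is
  -- trivial.
  rcases (normL1_nonneg (fun t => (u t : ℂ))).eq_or_lt with hM | hM
  · have hc : ∀ k, coeff (fun t => (u t : ℂ)) k = 0 := fun k => by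
      have := norm_coeff_le (fun t => (u t : ℂ)) k
      rw [← hM, zero_div] at this
      exact norm_le_zero_iff.1 this
    have : ∀ t, F (circleMap 0 r t) = 0 := fun t => by
      have := hasSum_cauchy hI (hmem t)
      simp only [hc, zero_mul] at this
      exact this.unique hasSum_zero
    simp [this, hp0]
  have hre : ∀ z : ℂ, ‖z‖ < 1 → 0 < (F z).re := fun z hz =>
    (div_pos hM (by positivity)).trans_le (le_re_cauchy hu h0 hz)
  have hd := differentiableOn_cauchy hI (R := (1 + r) / 2) (by linarith) (by linarith)
  have hd2 : DifferentiableOn ℂ (fun z => F z ^ (p : ℂ)) (Metric.ball 0 ((1 + r) / 2)) := by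
    refine hd.cpow (differentiableOn_const _) fun z hz => Or.inl (hre z ?_)
    rw [mem_ball_zero_iff] at hz
    linarith
  have hsub : Metric.closedBall (0 : ℂ) |r| ⊆ Metric.ball 0 ((1 + r) / 2) := by
    rw [abs_of_nonneg hr0]
    exact Metric.closedBall_subset_ball (by linarith)
  have havg := (hd2.diffContOnCl_ball hsub).circleAverage
  have hcirc : ∀ t, circleMap 0 r t ∈ Metric.ball (0 : ℂ) ((1 + r) / 2) := fun t => by
    rw [mem_ball_zero_iff, norm_circleMap_zero, abs_of_nonneg hr0]; linarith
  have hcF : Continuous fun t => F (circleMap 0 r t) :=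
    hd.continuousOn.comp_continuous (continuous_circleMap 0 r) hcirc
  have hcG : Continuous fun t => F (circleMap 0 r t) ^ (p : ℂ) :=
    hd2.continuousOn.comp_continuous (continuous_circleMap 0 r) hcirc
  have hcN : Continuous fun t => ‖F (circleMap 0 r t)‖ ^ p :=
    hcF.norm.rpow_const fun _ => Or.inr hp0.le
  have hiG : CircleIntegrable (fun z => F z ^ (p : ℂ)) 0 r := hcG.intervalIntegrable _ _
  have hmain : Real.cos (p * (Real.pi / 2)) * Real.circleAverage (fun z => ‖F z‖ ^ p) 0 r ≤
      normL1 (fun t => (u t : ℂ)) ^ p := by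
    calc Real.cos (p * (Real.pi / 2)) * Real.circleAverage (fun z => ‖F z‖ ^ p) 0 r
        = Real.circleAverage (fun z => Real.cos (p * (Real.pi / 2)) * ‖F z‖ ^ p) 0 r := by
          have := Real.circleAverage_fun_smul (a := Real.cos (p * (Real.pi / 2)))
            (f := fun z => ‖F z‖ ^ p) (c := (0 : ℂ)) (R := r)
          simpa only [smul_eq_mul] using this.symm
      _ ≤ Real.circleAverage (fun z => (F z ^ (p : ℂ)).re) 0 r := by
          refine Real.circleAverage_mono ((hcN.const_mul _).intervalIntegrable _ _)
            ((continuous_re.comp hcG).intervalIntegrable _ _) fun z hz => ?_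
          refine cos_mul_norm_rpow_le_re_cpow hp0.le hp1.le (hre z ?_)
          rw [mem_sphere_zero_iff_norm, abs_of_nonneg hr0] at hz
          rwa [hz]
      _ = (F 0 ^ (p : ℂ)).re := by
          have := reCLM.circleAverage_comp_comm hiG
          rw [havg] at this
          exact this
      _ ≤ ‖F 0‖ ^ p := by
          refine (re_le_norm _).trans_eq ?_
          exact norm_cpow_real _ _
      _ ≤ normL1 (fun t => (u t : ℂ)) ^ p := by
          gcongr
          rw [hF, cauchy_zero]
          refine (norm_coeff_le _ _).trans (div_le_self hM.le ?_)
          linarith [Real.pi_gt_three]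
  have hconv : ∀ z, ‖F z‖ₑ ^ p = ENNReal.ofReal (‖F z‖ ^ p) := fun z => by
    rw [← ENNReal.ofReal_rpow_of_nonneg (norm_nonneg _) hp0.le, ofReal_norm]
  simp only [hconv]
  rw [lintegral_torus_circleMap (fun z => ‖F z‖ ^ p) r (fun z => by positivity) hcN]
  apply ENNReal.ofReal_le_ofReal
  rw [div_mul_eq_mul_div, le_div_iff₀ hcos, mul_assoc, mul_comm _ (Real.cos _)]
  gcongr

theorem continuous_cauchy_circleMap {f : ℝ → ℂ} (hf : IntegrableOn f torus) {r : ℝ} (hr0 : 0 ≤ r)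
    (hr : r < 1) : Continuous fun t => cauchy f (circleMap 0 r t) := by
  have hd := differentiableOn_cauchy hf (R := (1 + r) / 2) (by linarith) (by linarith)
  refine hd.continuousOn.comp_continuous (continuous_circleMap 0 r) fun t => ?_
  rw [mem_ball_zero_iff, norm_circleMap_zero, abs_of_nonneg hr0]; linarith

theorem kolmogorov_cauchy {p : ℝ} (hp0 : 0 < p) (hp1 : p < 1) {f : ℝ → ℂ}
    (hf : IntegrableOn f torus) {r : ℝ} (hr0 : 0 ≤ r) (hr : r < 1) :
    ∫⁻ t in torus, ‖cauchy f (circleMap 0 r t)‖ₑ ^ p ≤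
      ENNReal.ofReal (8 * Real.pi / Real.cos (p * (Real.pi / 2)) * normL1 f ^ p) := by
  have hpi := Real.pi_pos
  have hcos : 0 < Real.cos (p * (Real.pi / 2)) :=
    Real.cos_pos_of_mem_Ioo ⟨by nlinarith, by nlinarith⟩
  -- Positive and negative parts of the real and imaginary parts; each is dominated by `|f|`, and
  -- the four terms turn `2π` into `8π`.
  let u : Fin 4 → ℝ → ℝ := ![fun t => max (f t).re 0, fun t => max (-(f t).re) 0,
    fun t => max (f t).im 0, fun t => max (-(f t).im) 0]
  let c : Fin 4 → ℂ := ![1, -1, I, -I]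
  have hu : ∀ i, IntegrableOn (u i) torus := by
    have h1 : IntegrableOn (fun t => (f t).re) torus := hf.re
    have h2 : IntegrableOn (fun t => (f t).im) torus := hf.im
    intro i
    fin_cases i
    · exact h1.pos_part
    · exact h1.neg_part
    · exact h2.pos_part
    · exact h2.neg_part
  have hu0 : ∀ i t, 0 ≤ u i t := fun i t => by fin_cases i <;> exact le_max_right _ _
  have hule : ∀ i t, u i t ≤ ‖f t‖ := fun i t => by
    have h1 := abs_re_le_norm (f t)
    have h2 := abs_im_le_norm (f t)
    have h3 := norm_nonneg (f t)
    rw [abs_le] at h1 h2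
    fin_cases i <;> refine max_le ?_ h3 <;> linarith
  have hsum : ∀ t, f t = ∑ i, c i * (u i t : ℂ) := fun t => by
    simp only [Fin.sum_univ_four, u, c]
    apply Complex.ext
    · simp
      rcases le_total (f t).re 0 with h | h <;> simp [h]
    · simp
      rcases le_total (f t).im 0 with h | h <;> simp [h]
  have hI : ∀ i, IntegrableOn (fun t => (u i t : ℂ)) torus := fun i => (hu i).ofReal
  have hcauchy : ∀ z : ℂ, ‖z‖ < 1 →
      cauchy f z = ∑ i, c i * cauchy (fun t => (u i t : ℂ)) z := fun z hz => by
    simp only [cauchy]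
    simp only [mul_left_comm (c _) (1 / (2 * (Real.pi : ℂ))), ← integral_const_mul (c _), ← Finset.mul_sum]
    rw [← integral_finsetSum _ fun i _ => (integrable_mul_cauchyKernel (hI i) hz).const_mul _]
    congr 2
    funext t
    rw [hsum t, Finset.sum_mul]
    simp only [mul_assoc]
  have hc : ∀ i, ‖c i‖ = 1 := fun i => by fin_cases i <;> simp [c]
  calc ∫⁻ t in torus, ‖cauchy f (circleMap 0 r t)‖ₑ ^ p
      ≤ ∫⁻ t in torus, ∑ i, ‖cauchy (fun t => (u i t : ℂ)) (circleMap 0 r t)‖ₑ ^ p := by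
        refine lintegral_mono fun t => ?_
        dsimp only
        rw [hcauchy _ (by rwa [norm_circleMap_zero, abs_of_nonneg hr0])]
        refine le_trans ?_ (Finset.le_sum_of_subadditive (fun x : ENNReal => x ^ p)
          (by simp [hp0]) (fun x y => ENNReal.rpow_add_le_add_rpow x y hp0.le hp1.le) _ _)
        gcongr
        refine (enorm_sum_le _ _).trans (Finset.sum_le_sum fun i _ => ?_)
        rw [enorm_mul, ← ofReal_norm (c i), hc]
        simp
    _ = ∑ i, ∫⁻ t in torus, ‖cauchy (fun t => (u i t : ℂ)) (circleMap 0 r t)‖ₑ ^ p :=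
        lintegral_finsetSum _ fun i _ =>
          ((continuous_cauchy_circleMap (hI i) hr0 hr).measurable.enorm.pow_const _)
    _ ≤ ∑ i : Fin 4, ENNReal.ofReal (2 * Real.pi / Real.cos (p * (Real.pi / 2)) * normL1 f ^ p) := by
        refine Finset.sum_le_sum fun i _ => (kolmogorov_nonneg hp0 hp1 (hu i) (hu0 i) hr0 hr).trans ?_
        have := normL1_nonneg (fun t => (u i t : ℂ))
        gcongr
        refine integral_mono (hI i).norm hf.norm fun t => ?_
        simpa [abs_of_nonneg (hu0 i t)] using hule i t
    _ = ENNReal.ofReal (8 * Real.pi / Real.cos (p * (Real.pi / 2)) * normL1 f ^ p) := by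
        rw [Finset.sum_const, Finset.card_univ, Fintype.card_fin, nsmul_eq_mul,
          ← ENNReal.ofReal_natCast, ← ENNReal.ofReal_mul (by positivity)]
        congr 1
        push_cast; ring

/-! ### Partial sums by modulation and Abel summation -/

theorem coeff_mul_exp (f : ℝ → ℂ) (k l : ℤ) :
    coeff (fun t => f t * exp (I * l * t)) k = coeff f (k - l) := by
  rw [coeff, coeff]
  congr 2
  funext t
  rw [mul_assoc, ← exp_add]
  congr 2
  push_cast; ring

theorem normL1_mul_exp (f : ℝ → ℂ) (l : ℤ) :
    normL1 (fun t => f t * exp (I * l * t)) = normL1 f := by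
  simp only [normL1, norm_mul, norm_exp_I_mul_int_mul, mul_one]

theorem integrableOn_mul_exp {f : ℝ → ℂ} (hf : IntegrableOn f torus) (l : ℤ) :
    IntegrableOn (fun t => f t * exp (I * l * t)) torus :=
  integrable_mul_of_norm_le_one hf (by fun_prop) fun t => (norm_exp_I_mul_int_mul l t).le

/-- A partial sum with Abel factors is a difference of two modulated Cauchy integrals. -/
theorem abel_partialSum_eq {f : ℝ → ℂ} (hf : IntegrableOn f torus) (n : ℕ) {r : ℝ}
    (hr0 : 0 ≤ r) (hr : r < 1) (y : ℝ) :
    ∑ k ∈ Finset.range (2 * n + 1), coeff f (k - n) * r ^ k * exp (I * k * y) =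
      cauchy (fun t => f t * exp (I * (n : ℤ) * t)) (circleMap 0 r y) -
      circleMap 0 r y ^ (2 * n + 1) *
        cauchy (fun t => f t * exp (I * (-(n + 1) : ℤ) * t)) (circleMap 0 r y) := by
  have hz : ‖circleMap 0 r y‖ < 1 := by rwa [norm_circleMap_zero, abs_of_nonneg hr0]
  have h1 := hasSum_cauchy (integrableOn_mul_exp hf n) hz
  have h2 := (hasSum_cauchy (integrableOn_mul_exp hf (-(n + 1))) hz).mul_left
    (circleMap 0 r y ^ (2 * n + 1))
  simp only [coeff_mul_exp] at h1 h2
  -- The tail of the first power series beyond degree `2n` is `z ^ (2n+1)` times the second one, so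
  -- subtracting leaves the polynomial part.
  have h3 := (hasSum_nat_add_iff' (2 * n + 1)).2 h1
  have h4 := h3.unique (h2.congr_fun fun k => ?_)
  · rw [← h4, sub_sub_cancel]
    refine Finset.sum_congr rfl fun k _ => ?_
    rw [circleMap_zero, mul_pow, ← exp_nat_mul, mul_assoc]
    congr 3
    ring_nf
  · rw [pow_add]
    have : ((k + (2 * n + 1) : ℕ) : ℤ) - n = k - -(n + 1) := by push_cast; ring
    rw [this]
    ring

theorem partialSum_eq_sum_range (n : ℕ) (f : ℝ → ℂ) (y : ℝ) :
    exp (I * n * y) * partialSum n f y =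
      ∑ k ∈ Finset.range (2 * n + 1), coeff f (k - n) * exp (I * k * y) := by
  rw [partialSum, Finset.mul_sum]
  refine Finset.sum_bij' (fun k _ => (k + n).toNat) (fun k _ => (k : ℤ) - n) ?_ ?_ ?_ ?_ ?_
  · intro k hk; simp only [Finset.mem_Icc, Finset.mem_range] at *; omega
  · intro k hk; simp only [Finset.mem_Icc, Finset.mem_range] at *; omega
  · intro k hk; simp only [Finset.mem_Icc] at *; omega
  · intro k hk; simp only [Finset.mem_range] at *; omega
  · intro k hk
    simp only [Finset.mem_Icc] at hk
    have h : (((k + n).toNat : ℕ) : ℤ) = k + n := by omega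
    have h' : (((k + n).toNat : ℕ) : ℂ) = k + n := by exact_mod_cast congrArg (Int.cast (R := ℂ)) h
    rw [h, h', add_sub_cancel_right, mul_left_comm, ← exp_add]
    congr 2
    ring

/-- Kolmogorov's inequality: the partial sums are bounded from `L¹` to `L^p`, `p < 1`. -/
theorem kolmogorov_partialSum {p : ℝ} (hp0 : 0 < p) (hp1 : p < 1) {f : ℝ → ℂ}
    (hf : IntegrableOn f torus) (n : ℕ) :
    ∫⁻ y in torus, ‖partialSum n f y‖ₑ ^ p ≤
      ENNReal.ofReal (16 * Real.pi / Real.cos (p * (Real.pi / 2)) * normL1 f ^ p) := by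
  have hpi := Real.pi_pos
  have hcos : 0 < Real.cos (p * (Real.pi / 2)) :=
    Real.cos_pos_of_mem_Ioo ⟨by nlinarith, by nlinarith⟩
  have hM := normL1_nonneg f
  let A : ℝ → ℝ → ℂ := fun r y =>
    ∑ k ∈ Finset.range (2 * n + 1), coeff f (k - n) * r ^ k * exp (I * k * y)
  have hbound : ∀ r : ℝ, 0 ≤ r → r < 1 → ∫⁻ y in torus, ‖A r y‖ₑ ^ p ≤
      ENNReal.ofReal (16 * Real.pi / Real.cos (p * (Real.pi / 2)) * normL1 f ^ p) := by
    intro r hr0 hr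
    have h1 := kolmogorov_cauchy hp0 hp1 (integrableOn_mul_exp hf n) hr0 hr
    have h2 := kolmogorov_cauchy hp0 hp1 (integrableOn_mul_exp hf (-(n + 1))) hr0 hr
    rw [normL1_mul_exp] at h1 h2
    have h3 : 16 * Real.pi / Real.cos (p * (Real.pi / 2)) * normL1 f ^ p =
        8 * Real.pi / Real.cos (p * (Real.pi / 2)) * normL1 f ^ p +
        8 * Real.pi / Real.cos (p * (Real.pi / 2)) * normL1 f ^ p := by ring
    rw [h3, ENNReal.ofReal_add (by positivity) (by positivity)]
    refine le_trans ?_ (add_le_add h1 h2)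
    rw [← lintegral_add_left
      ((continuous_cauchy_circleMap (integrableOn_mul_exp hf n) hr0 hr).measurable.enorm.pow_const _)]
    refine lintegral_mono fun y => ?_
    simp only [A]
    rw [abel_partialSum_eq hf n hr0 hr y]
    refine le_trans ?_ (ENNReal.rpow_add_le_add_rpow _ _ hp0.le hp1.le)
    gcongr
    refine (enorm_sub_le).trans ?_
    gcongr
    rw [enorm_mul, enorm_pow]
    refine mul_le_of_le_one_left' (pow_le_one' ?_ _)
    rw [← ofReal_norm, norm_circleMap_zero, abs_of_nonneg hr0]
    exact ENNReal.ofReal_le_one.2 hr.le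
  -- Radii in `[0, 1)` tending to `1`; Fatou's lemma carries the uniform bound to the limit.
  let ρ : ℕ → ℝ := fun m => 1 - 1 / ((m : ℝ) + 1)
  have hρ : Tendsto ρ atTop (𝓝 1) := by
    simpa [ρ] using (tendsto_one_div_add_atTop_nhds_zero_nat (𝕜 := ℝ)).const_sub 1
  have hlim : ∀ y, Tendsto (fun m => ‖A (ρ m) y‖ₑ ^ p) atTop (𝓝 (‖partialSum n f y‖ₑ ^ p)) := by
    intro y
    have hA : Continuous fun r => A r y := by simp only [A]; fun_prop
    have h1 : ‖A 1 y‖ₑ = ‖partialSum n f y‖ₑ := by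
      have h2 := partialSum_eq_sum_range n f y
      have h3 : ‖exp (I * n * y)‖ₑ = 1 := by
        have := norm_exp_I_mul_int_mul n y
        rw [← ofReal_norm]
        push_cast at this
        rw [this, ENNReal.ofReal_one]
      simp only [A, ofReal_one, one_pow, mul_one]
      rw [← h2, enorm_mul, h3, one_mul]
    rw [← h1]
    exact ((ENNReal.continuous_rpow_const.comp (continuous_enorm.comp hA)).tendsto 1).comp hρ
  calc ∫⁻ y in torus, ‖partialSum n f y‖ₑ ^ p
      = ∫⁻ y in torus, liminf (fun m => ‖A (ρ m) y‖ₑ ^ p) atTop := by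
        simp only [(hlim _).liminf_eq]
    _ ≤ liminf (fun m => ∫⁻ y in torus, ‖A (ρ m) y‖ₑ ^ p) atTop := by
        refine lintegral_liminf_le fun m => ?_
        have hA : Continuous fun y => A (ρ m) y := by simp only [A]; fun_prop
        exact hA.measurable.enorm.pow_const _
    _ ≤ _ := by
        refine liminf_le_of_frequently_le' (Frequently.of_forall fun m => hbound _ ?_ ?_)
        · have : 1 / ((m : ℝ) + 1) ≤ 1 := by
            rw [div_le_one (by positivity)]; linarith [(Nat.cast_nonneg m : (0 : ℝ) ≤ m)]
          simp only [ρ]; linarith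
        · have : 0 < 1 / ((m : ℝ) + 1) := by positivity
          simp only [ρ]; linarith

/-! ### The Fejér kernel and the `L¹` bound for Fejér means -/

/-- The Fejér kernel `(m + 1)⁻¹ |∑_{a ≤ m} e^{iax}|²`. -/
def fejerKernel (m : ℕ) (x : ℝ) : ℝ :=
  ‖∑ a ∈ Finset.range (m + 1), exp (I * a * x)‖ ^ 2 / (m + 1)

theorem fejerKernel_nonneg (m : ℕ) (x : ℝ) : 0 ≤ fejerKernel m x := by
  unfold fejerKernel; positivity

theorem continuous_fejerKernel (m : ℕ) : Continuous (fejerKernel m) := by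
  unfold fejerKernel; fun_prop

theorem conj_exp_I_mul (k : ℤ) (x : ℝ) :
    (starRingEnd ℂ) (exp (I * k * x)) = exp (I * (-k : ℤ) * x) := by
  rw [← exp_conj]
  simp

theorem sum_Icc_int_succ (g : ℤ → ℂ) (n : ℕ) :
    ∑ k ∈ Finset.Icc (-((n + 1 : ℕ) : ℤ)) ((n + 1 : ℕ) : ℤ), g k =
      ∑ k ∈ Finset.Icc (-(n : ℤ)) n, g k + (g (n + 1) + g (-(n + 1))) := by
  have h : Finset.Icc (-((n + 1 : ℕ) : ℤ)) ((n + 1 : ℕ) : ℤ) =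
      insert ((n : ℤ) + 1) (insert (-((n : ℤ) + 1)) (Finset.Icc (-(n : ℤ)) n)) := by
    ext k; simp only [Finset.mem_insert, Finset.mem_Icc]; push_cast; omega
  rw [h, Finset.sum_insert, Finset.sum_insert]
  · ring
  · simp only [Finset.mem_Icc]; omega
  · simp only [Finset.mem_insert, Finset.mem_Icc]; omega

theorem sum_Icc_int_eq_sum_range (g : ℤ → ℂ) (n : ℕ) :
    ∑ k ∈ Finset.Icc (-(n : ℤ)) n, g k =
      g 0 + ∑ a ∈ Finset.range n, (g (a + 1) + g (-(a + 1))) := by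
  induction n with
  | zero => simp
  | succ n ih => rw [sum_Icc_int_succ, ih, Finset.sum_range_succ]; ring

/-- Both sides count the frequency `k` with multiplicity `m + 1 - |k|`. The square makes the kernel
visibly nonnegative. -/
theorem sum_dirichlet_eq_normSq (m : ℕ) (x : ℝ) :
    ∑ n ∈ Finset.range (m + 1), ∑ k ∈ Finset.Icc (-(n : ℤ)) n, exp (I * k * x) =
      ((‖∑ a ∈ Finset.range (m + 1), exp (I * a * x)‖ ^ 2 : ℝ) : ℂ) := by
  induction m with
  | zero => simp
  | succ m ih =>
    rw [Finset.sum_range_succ, ih, Finset.sum_range_succ (fun a : ℕ => exp (I * a * x)) (m + 1)]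
    push_cast
    set A := ∑ a ∈ Finset.range (m + 1), exp (I * a * x) with hA
    have e1 : ∀ w : ℂ, (‖w‖ : ℂ) ^ 2 = w * (starRingEnd ℂ) w := fun w => (mul_conj' w).symm
    have hlast := conj_exp_I_mul (m + 1) x
    push_cast at hlast
    have hcA : (starRingEnd ℂ) A = ∑ a ∈ Finset.range (m + 1), exp (-(I * a * x)) := by
      rw [hA, map_sum]
      refine Finset.sum_congr rfl fun a _ => ?_
      have := conj_exp_I_mul a x
      push_cast at this
      rw [this]
      congr 1; ring
    -- With `e = exp (I (m+1) x)`, reversing the summation turns the next Dirichlet kernel into `1 +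
    -- e Ā + ē A`, which is `|A + e|² - |A|²`.
    have hflip : ∀ s : ℂ, ∑ a ∈ Finset.range (m + 1), exp (s * (a + 1)) =
        exp (s * (m + 1)) * ∑ a ∈ Finset.range (m + 1), exp (-(s * a)) := by
      intro s
      rw [← Finset.sum_range_reflect, Finset.mul_sum]
      refine Finset.sum_congr rfl fun a ha => ?_
      rw [Finset.mem_range] at ha
      rw [← exp_add]
      congr 1
      have : ((m + 1 - 1 - a : ℕ) : ℂ) = m - a := by
        rw [Nat.add_sub_cancel, Nat.cast_sub (by omega)]
      rw [this]; ring
    rw [e1, e1, map_add, hlast, hcA]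
    have := sum_Icc_int_eq_sum_range (fun k => exp (I * k * x)) (m + 1)
    push_cast at this
    rw [this, Finset.sum_add_distrib]
    have f1 := hflip (I * x)
    have f2 := hflip (-(I * x))
    have g1 : ∑ a ∈ Finset.range (m + 1), exp (I * (a + 1) * x) =
        exp (I * (m + 1) * x) * ∑ a ∈ Finset.range (m + 1), exp (-(I * a * x)) := by
      convert f1 using 3 <;> ring_nf
    have g2 : ∑ a ∈ Finset.range (m + 1), exp (I * (-(a + 1)) * x) =
        exp (I * (-(m + 1)) * x) * A := by
      rw [hA]
      convert f2 using 3 <;> ring_nf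
    have g3 : exp (I * (m + 1) * x) * exp (I * (-(m + 1)) * x) = 1 := by
      rw [← exp_add]; simp [← add_mul, ← mul_add]
    rw [mul_zero, zero_mul, exp_zero, g1, g2]
    linear_combination -g3

theorem fejer_eq_integral {f : ℝ → ℂ} (hf : IntegrableOn f torus) (m : ℕ) (y : ℝ) :
    fejer m f y = (1 / (2 * (Real.pi : ℂ))) * ∫ t in torus, f t * (fejerKernel m (y - t) : ℂ) := by
  have h1 : ∀ n : ℕ, partialSum n f y = (1 / (2 * (Real.pi : ℂ))) *
      ∫ t in torus, f t * ∑ k ∈ Finset.Icc (-(n : ℤ)) n, exp (I * k * (y - t : ℝ)) := by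
    intro n
    simp only [partialSum, coeff, Finset.mul_sum]
    rw [integral_finsetSum, Finset.mul_sum]
    · refine Finset.sum_congr rfl fun k _ => ?_
      rw [mul_assoc, ← integral_mul_const]
      congr 2
      funext t
      rw [mul_assoc, ← exp_add]
      congr 2
      push_cast; ring
    · intro k _
      exact integrable_mul_of_norm_le_one hf (by fun_prop) fun t =>
        (norm_exp_I_mul_int_mul k _).le
  have hm : (m : ℂ) + 1 ≠ 0 := by exact_mod_cast m.succ_ne_zero
  rw [fejer]
  simp only [h1]
  rw [← Finset.mul_sum, ← integral_finsetSum, mul_left_comm, ← integral_const_mul]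
  · congr 2
    funext t
    rw [← Finset.mul_sum, sum_dirichlet_eq_normSq, fejerKernel]
    push_cast
    rw [mul_left_comm, one_div, div_eq_inv_mul]
  · intro n _
    simp only [Finset.mul_sum]
    exact integrable_finsetSum _ fun k _ => integrable_mul_of_norm_le_one hf (by fun_prop) fun t =>
        (norm_exp_I_mul_int_mul k _).le

theorem coeff_one (k : ℤ) : coeff (fun _ => 1) k = if k = 0 then 1 else 0 := by
  have hp : (Real.pi : ℂ) ≠ 0 := by exact_mod_cast Real.pi_ne_zero
  have hpi := Real.pi_pos
  rw [coeff]
  split_ifs with h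
  · subst h
    simp only [Int.cast_zero, mul_zero, zero_mul, neg_zero, exp_zero, mul_one]
    rw [setIntegral_const]
    simp [torus, Real.volume_real_Ico_of_le (show -Real.pi ≤ Real.pi by linarith)]
    field_simp
    norm_num
  · have hk : (-(I * k)) ≠ 0 := by simp [h]
    have := integral_exp_mul_complex (a := -Real.pi) (b := Real.pi) hk
    rw [intervalIntegral.integral_of_le (by linarith)] at this
    rw [torus, integral_Ico_eq_integral_Ioc]
    simp only [one_mul]
    have e : ∀ t : ℝ, exp (-(I * k * t)) = exp (-(I * k) * t) := fun t => by rw [neg_mul]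
    simp only [e]
    rw [this]
    refine mul_eq_zero_of_right _ (div_eq_zero_iff.2 (Or.inl ?_))
    rw [sub_eq_zero, exp_eq_exp_iff_exists_int]
    exact ⟨-k, by push_cast; ring⟩

theorem integrableOn_one : IntegrableOn (fun _ => (1 : ℂ)) torus :=
  integrable_const _

theorem fejer_one (m : ℕ) (y : ℝ) : fejer m (fun _ => 1) y = 1 := by
  have hm : (m : ℂ) + 1 ≠ 0 := by exact_mod_cast m.succ_ne_zero
  have : ∀ n : ℕ, partialSum n (fun _ => 1) y = 1 := fun n => by
    simp only [partialSum, coeff_one, ite_mul, one_mul, zero_mul]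
    rw [Finset.sum_ite_eq' _ (0 : ℤ)]
    simp
  simp only [fejer, this]
  simp [hm]

/-- The normalisation is read off from `σ_m 1 = 1`, with no direct integration of the kernel. -/
theorem integral_fejerKernel (m : ℕ) (y : ℝ) :
    ∫ t in torus, fejerKernel m (y - t) = 2 * Real.pi := by
  have h := fejer_eq_integral integrableOn_one m y
  simp only [fejer_one, one_mul] at h
  have hp : (Real.pi : ℂ) ≠ 0 := by exact_mod_cast Real.pi_ne_zero
  have h2 : ∫ t in torus, (fejerKernel m (y - t) : ℂ) = 2 * Real.pi := by
    field_simp at h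
    exact h.symm
  rw [integral_complex_ofReal] at h2
  exact_mod_cast h2

theorem fejerKernel_neg (m : ℕ) (x : ℝ) : fejerKernel m (-x) = fejerKernel m x := by
  have : ∑ a ∈ Finset.range (m + 1), exp (I * a * (-x : ℝ)) =
      (starRingEnd ℂ) (∑ a ∈ Finset.range (m + 1), exp (I * a * x)) := by
    rw [map_sum]
    refine Finset.sum_congr rfl fun a _ => ?_
    rw [← exp_conj]
    simp
  rw [fejerKernel, this, RCLike.norm_conj, fejerKernel]

theorem lintegral_fejerKernel (m : ℕ) (t : ℝ) :
    ∫⁻ y in torus, ENNReal.ofReal (fejerKernel m (y - t)) = ENNReal.ofReal (2 * Real.pi) := by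
  rw [← integral_fejerKernel m t, ofReal_integral_eq_lintegral_ofReal]
  · refine lintegral_congr fun y => ?_
    rw [← fejerKernel_neg, neg_sub]
  · exact ((continuous_fejerKernel m).comp (by fun_prop)).continuousOn.integrableOn_Icc.mono_set
      Ico_subset_Icc_self
  · exact Eventually.of_forall fun t => fejerKernel_nonneg _ _

theorem enorm_fejer_le {f : ℝ → ℂ} (hf : IntegrableOn f torus) (m : ℕ) (y : ℝ) :
    ‖fejer m f y‖ₑ ≤ ENNReal.ofReal (1 / (2 * Real.pi)) *
      ∫⁻ t in torus, ‖f t‖ₑ * ENNReal.ofReal (fejerKernel m (y - t)) := by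
  rw [fejer_eq_integral hf, enorm_mul]
  gcongr
  · rw [← ofReal_norm]
    apply ENNReal.ofReal_le_ofReal
    simp [abs_of_pos Real.pi_pos]
  · refine (enorm_integral_le_lintegral_enorm _).trans (lintegral_mono fun t => ?_)
    dsimp only
    rw [enorm_mul]
    gcongr
    rw [← ofReal_norm, norm_real, Real.norm_of_nonneg (fejerKernel_nonneg _ _)]

theorem lintegral_enorm_eq_normL1 {f : ℝ → ℂ} (hf : IntegrableOn f torus) :
    ∫⁻ t in torus, ‖f t‖ₑ = ENNReal.ofReal (normL1 f) := by
  rw [normL1, ofReal_integral_norm_eq_lintegral_enorm hf]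

/-- Tonelli's theorem, the kernel being nonnegative with mean value one. -/
theorem lintegral_fejer_le {f : ℝ → ℂ} (hf : IntegrableOn f torus) (m : ℕ) :
    ∫⁻ y in torus, ‖fejer m f y‖ₑ ≤ ENNReal.ofReal (normL1 f) := by
  have hpi := Real.pi_pos
  have hK : Measurable fun q : ℝ × ℝ => ENNReal.ofReal (fejerKernel m (q.1 - q.2)) :=
    ENNReal.measurable_ofReal.comp
      ((continuous_fejerKernel m).comp (continuous_fst.sub continuous_snd)).measurable
  calc ∫⁻ y in torus, ‖fejer m f y‖ₑ
      ≤ ∫⁻ y in torus, ENNReal.ofReal (1 / (2 * Real.pi)) *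
        ∫⁻ t in torus, ‖f t‖ₑ * ENNReal.ofReal (fejerKernel m (y - t)) :=
        lintegral_mono fun y => enorm_fejer_le hf m y
    _ = ENNReal.ofReal (1 / (2 * Real.pi)) *
        ∫⁻ y in torus, ∫⁻ t in torus, ‖f t‖ₑ * ENNReal.ofReal (fejerKernel m (y - t)) :=
        lintegral_const_mul' _ _ ENNReal.ofReal_ne_top
    _ = ENNReal.ofReal (1 / (2 * Real.pi)) *
        ∫⁻ t in torus, ∫⁻ y in torus, ‖f t‖ₑ * ENNReal.ofReal (fejerKernel m (y - t)) := by
        rw [lintegral_lintegral_swap]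
        exact (hf.aestronglyMeasurable.enorm.comp_snd).mul hK.aemeasurable
    _ = ENNReal.ofReal (normL1 f) := by
        simp only [lintegral_const_mul' _ _ enorm_ne_top, lintegral_fejerKernel]
        rw [lintegral_mul_const' _ _ ENNReal.ofReal_ne_top, lintegral_enorm_eq_normL1 hf, mul_comm,
          mul_assoc, ← ENNReal.ofReal_mul (by positivity)]
        rw [mul_one_div_cancel (by positivity), ENNReal.ofReal_one, mul_one]

/-! ### De la Vallée-Poussin means and the `L¹` to `L^p` bound for `S_n - V_n` -/

theorem valleePoussin_eq_fejer {n : ℕ} (hn : 1 ≤ n) (f : ℝ → ℂ) (y : ℝ) :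
    valleePoussin n f y = 2 * fejer (2 * n - 1) f y - fejer (n - 1) f y := by
  have hn0 : (n : ℂ) ≠ 0 := by exact_mod_cast (by omega : n ≠ 0)
  rw [valleePoussin, fejer, fejer, Finset.sum_Ico_eq_sub _ (by omega),
    Nat.sub_add_cancel (by omega : 1 ≤ 2 * n), Nat.sub_add_cancel hn,
    Nat.cast_sub (by omega : 1 ≤ 2 * n), Nat.cast_sub hn]
  push_cast
  rw [sub_add_cancel, sub_add_cancel]
  field_simp

theorem continuous_partialSum (n : ℕ) (f : ℝ → ℂ) : Continuous (partialSum n f) := by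
  unfold partialSum; fun_prop

theorem continuous_fejer (n : ℕ) (f : ℝ → ℂ) : Continuous (fejer n f) := by
  have := fun k => continuous_partialSum k f
  unfold fejer; fun_prop

theorem continuous_valleePoussin (n : ℕ) (f : ℝ → ℂ) : Continuous (valleePoussin n f) := by
  have := fun k => continuous_partialSum k f
  unfold valleePoussin; fun_prop

theorem lintegral_valleePoussin_le {f : ℝ → ℂ} (hf : IntegrableOn f torus) {n : ℕ} (hn : 1 ≤ n) :
    ∫⁻ y in torus, ‖valleePoussin n f y‖ₑ ≤ ENNReal.ofReal (3 * normL1 f) := by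
  have hM := normL1_nonneg f
  calc ∫⁻ y in torus, ‖valleePoussin n f y‖ₑ
      ≤ ∫⁻ y in torus, (2 * ‖fejer (2 * n - 1) f y‖ₑ + ‖fejer (n - 1) f y‖ₑ) := by
        refine lintegral_mono fun y => ?_
        dsimp only
        rw [valleePoussin_eq_fejer hn]
        refine enorm_sub_le.trans_eq ?_
        rw [enorm_mul]
        congr 2
        rw [← ofReal_norm]; simp
    _ = 2 * (∫⁻ y in torus, ‖fejer (2 * n - 1) f y‖ₑ) + ∫⁻ y in torus, ‖fejer (n - 1) f y‖ₑ := by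
        rw [lintegral_add_right _ (continuous_fejer _ f).measurable.enorm,
          lintegral_const_mul' _ _ (by simp)]
    _ ≤ 2 * ENNReal.ofReal (normL1 f) + ENNReal.ofReal (normL1 f) := by
        gcongr <;> exact lintegral_fejer_le hf _
    _ = ENNReal.ofReal (3 * normL1 f) := by
        rw [show 3 * normL1 f = 2 * normL1 f + normL1 f by ring,
          ENNReal.ofReal_add (by positivity) hM, ENNReal.ofReal_mul two_pos.le]
        simp

theorem lintegral_rpow_le_of_lintegral_le {g : ℝ → ENNReal} (hg : AEMeasurable g (volume.restrict torus))
    {p M : ℝ} (hp0 : 0 < p) (hp1 : p < 1) (hM : 0 ≤ M)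
    (h : ∫⁻ y in torus, g y ≤ ENNReal.ofReal M) :
    ∫⁻ y in torus, g y ^ p ≤ ENNReal.ofReal ((2 * Real.pi) ^ (1 - p) * M ^ p) := by
  have hpi := Real.pi_pos
  -- Hölder's inequality against the constant `1`, on a space of measure `2π`.
  have hH := ENNReal.lintegral_mul_le_Lp_mul_Lq (volume.restrict torus)
    (p := 1 / p) (q := 1 / (1 - p)) (f := fun y => g y ^ p) (g := fun _ => 1)
    ⟨by simp, by positivity, by have : 0 < 1 - p := by linarith
                                positivity⟩ (hg.pow_const _) aemeasurable_const
  have hv : volume torus = ENNReal.ofReal (2 * Real.pi) := by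
    rw [torus, Real.volume_Ico]; congr 1; ring
  simp only [Pi.mul_apply, mul_one, ← ENNReal.rpow_mul, ENNReal.one_rpow, lintegral_const,
    Measure.restrict_apply MeasurableSet.univ, univ_inter, one_mul, one_div, inv_inv,
    mul_inv_cancel₀ hp0.ne', ENNReal.rpow_one, hv] at hH
  refine hH.trans ?_
  rw [mul_comm, ENNReal.ofReal_mul (p := (2 * Real.pi) ^ (1 - p)) (by positivity),
    ← ENNReal.ofReal_rpow_of_nonneg (x := 2 * Real.pi) (by positivity) (by linarith), ← ENNReal.ofReal_rpow_of_nonneg hM hp0.le]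
  gcongr

/-- The differences `S_n - V_n` are bounded from `L¹` to `L^p`, `p < 1`, uniformly in `n`. -/
theorem exists_lintegral_partialSum_sub_valleePoussin_le {p : ℝ} (hp0 : 0 < p) (hp1 : p < 1) :
    ∃ C : ℝ, 0 < C ∧ ∀ f : ℝ → ℂ, IntegrableOn f torus → ∀ n : ℕ, 1 ≤ n →
      ∫⁻ y in torus, ‖partialSum n f y - valleePoussin n f y‖ₑ ^ p ≤
        ENNReal.ofReal (C * normL1 f ^ p) := by
  have hpi := Real.pi_pos
  have hcos : 0 < Real.cos (p * (Real.pi / 2)) :=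
    Real.cos_pos_of_mem_Ioo ⟨by nlinarith, by nlinarith⟩
  refine ⟨16 * Real.pi / Real.cos (p * (Real.pi / 2)) + (2 * Real.pi) ^ (1 - p) * 3 ^ p,
    by positivity, fun f hf n hn => ?_⟩
  have hM := normL1_nonneg f
  rw [add_mul, ENNReal.ofReal_add (by positivity) (by positivity)]
  calc ∫⁻ y in torus, ‖partialSum n f y - valleePoussin n f y‖ₑ ^ p
      ≤ ∫⁻ y in torus, (‖partialSum n f y‖ₑ ^ p + ‖valleePoussin n f y‖ₑ ^ p) := by
        refine lintegral_mono fun y => le_trans ?_ (ENNReal.rpow_add_le_add_rpow _ _ hp0.le hp1.le)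
        gcongr
        exact enorm_sub_le
    _ = _ := lintegral_add_left ((continuous_partialSum n f).measurable.enorm.pow_const _) _
    _ ≤ _ := by
        refine add_le_add (kolmogorov_partialSum hp0 hp1 hf n) ?_
        rw [mul_assoc, ← Real.mul_rpow (by norm_num) hM]
        exact lintegral_rpow_le_of_lintegral_le
          (continuous_valleePoussin n f).measurable.enorm.aemeasurable hp0 hp1 (by positivity)
          (lintegral_valleePoussin_le hf hn)

/-! ### Tail of the Fejér kernel by comparison with the Poisson kernel -/

theorem fejerKernel_mul_chord_sq_le (m : ℕ) (x : ℝ) :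
    fejerKernel m x * ‖1 - exp (I * x)‖ ^ 2 ≤ 4 / (m + 1) := by
  have h : (∑ a ∈ Finset.range (m + 1), exp (I * a * x)) * (1 - exp (I * x)) =
      1 - exp (I * x) ^ (m + 1) := by
    rw [← geom_sum_mul_neg]
    congr 1
    refine Finset.sum_congr rfl fun a _ => ?_
    rw [← exp_nat_mul]; congr 1; ring
  have h1 : ‖exp (I * x)‖ = 1 := by rw [mul_comm]; exact norm_exp_ofReal_mul_I x
  have h2 : ‖1 - exp (I * x) ^ (m + 1)‖ ≤ 2 := by
    refine (norm_sub_le _ _).trans ?_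
    rw [norm_pow, h1]; norm_num
  rw [fejerKernel, div_mul_eq_mul_div, ← mul_pow, ← norm_mul, h]
  gcongr
  nlinarith [norm_nonneg (1 - exp (I * x) ^ (m + 1))]

theorem cauchy_one {z : ℂ} (hz : ‖z‖ < 1) : cauchy (fun _ => 1) z = 1 := by
  have h := hasSum_cauchy integrableOn_one hz
  simp only [coeff_one] at h
  refine h.unique ?_
  have := hasSum_single (f := fun k : ℕ => (if (k : ℤ) = 0 then (1 : ℂ) else 0) * z ^ k) 0
    fun k hk => by simp [hk]
  simpa using this

/-- Up to the factor `1 - |w|²` the left side is the Poisson kernel, the real part of a Cauchy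
kernel; its integral thus follows from `cauchy_one`. -/
theorem inv_norm_one_sub_sq {w : ℂ} (hw : ‖w‖ < 1) :
    (‖1 - w‖ ^ 2)⁻¹ = (2 * ((1 - w)⁻¹).re - 1) / (1 - ‖w‖ ^ 2) := by
  have h1 : 1 - w ≠ 0 := by
    intro h
    rw [sub_eq_zero] at h
    simp [← h] at hw
  have h2 : 0 < 1 - ‖w‖ ^ 2 := by nlinarith [norm_nonneg w]
  have h3 := normSq_pos.2 h1
  rw [inv_re, ← normSq_eq_norm_sq, eq_div_iff h2.ne', inv_mul_eq_div, div_eq_iff h3.ne', sub_mul,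
    mul_assoc, div_mul_cancel₀ _ h3.ne', ← normSq_eq_norm_sq, normSq_apply, normSq_apply]
  simp only [sub_re, one_re, sub_im, one_im]
  ring

theorem continuous_inv_norm_one_sub_sq {z : ℂ} (hz : ‖z‖ < 1) :
    Continuous fun t : ℝ => (‖1 - z * exp (-(I * t))‖ ^ 2)⁻¹ := by
  refine Continuous.inv₀ (by fun_prop) fun t h => ?_
  have h1 : 1 - z * exp (-(I * t)) = 0 := by simpa using h
  have h2 : ‖z * exp (-(I * t))‖ = 1 := by rw [← sub_eq_zero.1 h1, norm_one]
  rw [norm_mul, norm_exp_neg_I_mul, mul_one] at h2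
  linarith

/-- The mean value of the Poisson kernel. -/
theorem integral_inv_norm_one_sub_sq {z : ℂ} (hz : ‖z‖ < 1) :
    ∫ t in torus, (‖1 - z * exp (-(I * t))‖ ^ 2)⁻¹ = 2 * Real.pi / (1 - ‖z‖ ^ 2) := by
  have hpi := Real.pi_pos
  have hn : ∀ t : ℝ, ‖z * exp (-(I * t))‖ = ‖z‖ := fun t => by
    rw [norm_mul, norm_exp_neg_I_mul, mul_one]
  have h1 : IntegrableOn (fun _ => (1 : ℝ)) torus := integrable_const _
  have h2 := re_cauchy_ofReal h1 hz
  simp only [ofReal_one, cauchy_one hz, one_re, one_mul] at h2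
  have h3 : ∫ t in torus, ((1 - z * exp (-(I * t)))⁻¹).re = 2 * Real.pi := by
    rwa [eq_comm, one_div, inv_mul_eq_iff_eq_mul₀ (by positivity), mul_one] at h2
  have h4 := (integrable_mul_cauchyKernel integrableOn_one hz).re
  simp only [one_mul, RCLike.re_to_complex] at h4
  have h5 : ∀ t : ℝ, (‖1 - z * exp (-(I * t))‖ ^ 2)⁻¹ =
      (2 * ((1 - z * exp (-(I * t)))⁻¹).re - 1) / (1 - ‖z‖ ^ 2) := fun t => by
    rw [inv_norm_one_sub_sq (by rwa [hn]), hn]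
  simp only [h5]
  rw [integral_div, integral_sub (h4.const_mul 2) h1, integral_const_mul, h3, setIntegral_const]
  congr 1
  simp [torus, Real.volume_real_Ico_of_le (show -Real.pi ≤ Real.pi by linarith)]
  ring

/-- The mass of the Fejér kernel at distance at least `c` from the point `y`. -/
theorem setIntegral_fejerKernel_le (m : ℕ) {c y : ℝ} (hc0 : 0 < c) (hc1 : c < 1) {E : Set ℝ}
    (hE : MeasurableSet E) (hET : E ⊆ torus)
    (h : ∀ t ∈ E, c ≤ ‖1 - exp (I * (y - t : ℝ))‖) :
    ∫ t in E, fejerKernel m (y - t) ≤ 16 * Real.pi / ((m + 1) * c) := by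
  have hpi := Real.pi_pos
  -- At depth `c` below the boundary the Poisson denominator is comparable to the squared chord
  -- wherever the chord is at least `c`.
  set z : ℂ := ((1 - c : ℝ) : ℂ) * exp (I * y) with hz
  have h1 : ‖exp (I * y)‖ = 1 := by rw [mul_comm]; exact norm_exp_ofReal_mul_I y
  have hzn : ‖z‖ = 1 - c := by
    rw [hz, norm_mul, h1, mul_one, norm_real, Real.norm_of_nonneg (by linarith)]
  have hz1 : ‖z‖ < 1 := by linarith
  have hint : IntegrableOn (fun t : ℝ => (‖1 - z * exp (-(I * t))‖ ^ 2)⁻¹) torus :=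
    (continuous_inv_norm_one_sub_sq hz1).continuousOn.integrableOn_Icc.mono_set
      Ico_subset_Icc_self
  have hKint : IntegrableOn (fun t => fejerKernel m (y - t)) torus :=
    ((continuous_fejerKernel m).comp (by fun_prop)).continuousOn.integrableOn_Icc.mono_set
      Ico_subset_Icc_self
  have hpt : ∀ t ∈ E, fejerKernel m (y - t) ≤
      8 / (m + 1) * (‖1 - z * exp (-(I * t))‖ ^ 2)⁻¹ := by
    intro t ht
    have hd := h t ht
    set d := ‖1 - exp (I * (y - t : ℝ))‖ with hdd
    have hK := fejerKernel_mul_chord_sq_le m (y - t)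
    rw [← hdd] at hK
    have hw : z * exp (-(I * t)) = ((1 - c : ℝ) : ℂ) * exp (I * (y - t : ℝ)) := by
      rw [hz, mul_assoc, ← exp_add]; congr 2; push_cast; ring
    have hsplit : 1 - z * exp (-(I * t)) = (c : ℂ) * exp (I * (y - t : ℝ)) +
        (1 - exp (I * (y - t : ℝ))) := by rw [hw]; push_cast; ring
    have hne : 0 < ‖1 - z * exp (-(I * t))‖ := by
      have := norm_sub_norm_le 1 (z * exp (-(I * t)))
      rw [norm_mul, norm_exp_neg_I_mul, mul_one, norm_one] at this
      linarith
    have hle : ‖1 - z * exp (-(I * t))‖ ^ 2 ≤ 2 * d ^ 2 := by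
      have e1 : ‖1 - exp (I * (y - t : ℝ))‖ ^ 2 = 2 - 2 * Real.cos (y - t) := by
        rw [← normSq_eq_norm_sq, normSq_apply]
        simp only [sub_re, sub_im, one_re, one_im, exp_re, exp_im, mul_re, mul_im, I_re, I_im,
          ofReal_re, ofReal_im]
        norm_num
        nlinarith [Real.sin_sq_add_cos_sq (y - t)]
      have e2 : ‖1 - z * exp (-(I * t))‖ ^ 2 =
          1 - 2 * (1 - c) * Real.cos (y - t) + (1 - c) ^ 2 := by
        rw [hw, ← normSq_eq_norm_sq, normSq_apply]
        simp only [sub_re, sub_im, one_re, one_im, exp_re, exp_im, mul_re, mul_im, I_re, I_im,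
          ofReal_re, ofReal_im]
        norm_num
        nlinarith [Real.sin_sq_add_cos_sq (y - t)]
      rw [← hdd] at e1
      -- The left side equals `c² + (1 - c) d²`, and `c ≤ d`.
      nlinarith
    have hm : (0 : ℝ) < m + 1 := by positivity
    rw [← div_eq_mul_inv, le_div_iff₀ (by positivity)]
    calc fejerKernel m (y - t) * ‖1 - z * exp (-(I * t))‖ ^ 2
        ≤ fejerKernel m (y - t) * (2 * d ^ 2) := by
          gcongr; exact fejerKernel_nonneg _ _
      _ = 2 * (fejerKernel m (y - t) * d ^ 2) := by ring
      _ ≤ 2 * (4 / (m + 1)) := by gcongr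
      _ = 8 / (m + 1) := by ring
  calc ∫ t in E, fejerKernel m (y - t)
      ≤ ∫ t in E, 8 / (m + 1) * (‖1 - z * exp (-(I * t))‖ ^ 2)⁻¹ :=
        setIntegral_mono_on (hKint.mono_set hET) ((hint.mono_set hET).const_mul _) hE hpt
    _ ≤ ∫ t in torus, 8 / (m + 1) * (‖1 - z * exp (-(I * t))‖ ^ 2)⁻¹ :=
        setIntegral_mono_set (hint.const_mul _) (Eventually.of_forall fun t => by positivity)
          hET.eventuallyLE
    _ = 8 / (m + 1) * (2 * Real.pi / (1 - (1 - c) ^ 2)) := by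
        rw [integral_const_mul, integral_inv_norm_one_sub_sq hz1, hzn]
    _ ≤ 8 / (m + 1) * (2 * Real.pi / c) := by
        gcongr; nlinarith
    _ = 16 * Real.pi / ((m + 1) * c) := by field_simp; ring

/-- Since `σ_m 1 = 1`, the difference is minus the Fejér mean of the characteristic function of `E`.
-/
theorem norm_fejer_indicator_compl_sub_one_le (m : ℕ) {E : Set ℝ} (hE : MeasurableSet E)
    (hET : E ⊆ torus) (y : ℝ) :
    ‖fejer m (indicator (torus \ E) fun _ => (1 : ℂ)) y - 1‖ ≤
      1 / (2 * Real.pi) * ∫ t in E, fejerKernel m (y - t) := by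
  have hpi := Real.pi_pos
  have hKint : IntegrableOn (fun t => (fejerKernel m (y - t) : ℂ)) torus :=
    (continuous_ofReal.comp ((continuous_fejerKernel m).comp
      (continuous_const.sub continuous_id))).continuousOn.integrableOn_Icc.mono_set
      Ico_subset_Icc_self
  have hind : IntegrableOn (indicator (torus \ E) fun _ => (1 : ℂ)) torus :=
    integrableOn_one.indicator (measurableSet_torus.diff hE)
  have h0 : fejer m (indicator (torus \ E) fun _ => (1 : ℂ)) y - 1 =
      fejer m (indicator (torus \ E) fun _ => (1 : ℂ)) y - fejer m (fun _ => 1) y := by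
    rw [fejer_one]
  rw [h0, fejer_eq_integral hind, fejer_eq_integral integrableOn_one, ← mul_sub,
    norm_mul]
  have h1 : ∫ t in torus, indicator (torus \ E) (fun _ => (1 : ℂ)) t * (fejerKernel m (y - t) : ℂ) =
      ∫ t in torus \ E, (fejerKernel m (y - t) : ℂ) := by
    rw [← integral_indicator measurableSet_torus,
      ← integral_indicator (measurableSet_torus.diff hE)]
    congr 1
    funext t
    by_cases ht : t ∈ torus <;> by_cases ht' : t ∈ E <;> simp [ht, ht', indicator]
  have h2 := setIntegral_union (μ := volume) (f := fun t => (fejerKernel m (y - t) : ℂ))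
    (disjoint_sdiff_left (t := torus) (s := E)) hE (hKint.mono_set sdiff_subset) (hKint.mono_set hET)
  rw [sdiff_union_of_subset hET] at h2
  have h3 : ‖1 / (2 * (Real.pi : ℂ))‖ = 1 / (2 * Real.pi) := by simp [abs_of_pos hpi]
  simp only [one_mul] at *
  rw [h1, h2, h3, sub_add_cancel_left, norm_neg, integral_complex_ofReal, norm_real,
    Real.norm_of_nonneg (setIntegral_nonneg hE fun t _ => fejerKernel_nonneg _ _)]

/-- Reduce `x` modulo `2π` to `[-π, π]`; the chord is `2 |sin (x/2)|`, and Jordan's inequality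
applies. -/
theorem chord_ge {x ε : ℝ} (h : ∀ k : ℤ, ε ≤ |x - 2 * Real.pi * k|) :
    2 / Real.pi * ε ≤ ‖1 - exp (I * x)‖ := by
  have hpi := Real.pi_pos
  set k : ℤ := round (x / (2 * Real.pi)) with hk
  set x' := x - 2 * Real.pi * k with hx'
  have h1 : |x'| ≤ Real.pi := by
    have := abs_sub_round (x / (2 * Real.pi))
    rw [← hk] at this
    have e : x' = 2 * Real.pi * (x / (2 * Real.pi) - k) := by rw [hx']; field_simp
    rw [e, abs_mul, abs_of_pos (by positivity)]
    nlinarith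
  have h2 : exp (I * x) = exp (I * x') := by
    rw [exp_eq_exp_iff_exists_int]
    exact ⟨k, by rw [hx']; push_cast; ring⟩
  have h3 := Real.mul_abs_le_abs_sin (x := x' / 2) (by rw [abs_div, abs_two]; linarith)
  rw [h2, norm_sub_rev, norm_exp_I_mul_ofReal_sub_one, norm_mul, Real.norm_two, Real.norm_eq_abs]
  rw [abs_div, abs_two] at h3
  have h4 : 2 / Real.pi * ε ≤ 2 / Real.pi * |x'| := by gcongr; exact h k
  linarith

/-! ### Dyadic intervals and their dilates -/

theorem exists_eq_Ico_of_mem_dyadicIntervals {A : Set ℝ} (hA : A ∈ dyadicIntervals) :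
    ∃ a h : ℝ, 0 < h ∧ h ≤ 2 * Real.pi ∧ A = Ico a (a + h) := by
  have hpi := Real.pi_pos
  obtain ⟨n, k, -, rfl⟩ := hA
  refine ⟨-Real.pi + 2 * Real.pi * k / 2 ^ n, 2 * Real.pi / 2 ^ n, by positivity,
    div_le_self (by positivity) (one_le_pow₀ one_le_two), ?_⟩
  congr 1
  ring

theorem volume_real_Ico_add {a h : ℝ} (hh : 0 < h) : volume.real (Ico a (a + h)) = h := by
  rw [Real.volume_real_Ico_of_le (by linarith)]; ring

theorem measurableSet_of_mem_dyadicIntervals {A : Set ℝ} (hA : A ∈ dyadicIntervals) :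
    MeasurableSet A := by
  obtain ⟨a, h, -, -, rfl⟩ := exists_eq_Ico_of_mem_dyadicIntervals hA
  exact measurableSet_Ico

theorem subset_torus_of_mem_dyadicIntervals {A : Set ℝ} (hA : A ∈ dyadicIntervals) :
    A ⊆ torus := by
  have hpi := Real.pi_pos
  obtain ⟨n, k, hk, rfl⟩ := hA
  have hk' : (k : ℝ) + 1 ≤ 2 ^ n := by exact_mod_cast hk
  refine Ico_subset_Ico ?_ ?_
  · have : 0 ≤ 2 * Real.pi * k / 2 ^ n := by positivity
    linarith
  · have : 2 * Real.pi * (k + 1) / 2 ^ n ≤ 2 * Real.pi := by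
      rw [div_le_iff₀ (by positivity)]; gcongr
    linarith

theorem countable_dyadicIntervals : dyadicIntervals.Countable := by
  refine (countable_range fun q : ℕ × ℕ => Ico (-Real.pi + 2 * Real.pi * q.2 / 2 ^ q.1)
    (-Real.pi + 2 * Real.pi * (q.2 + 1) / 2 ^ q.1)).mono ?_
  rintro A ⟨n, k, -, rfl⟩
  exact ⟨(n, k), rfl⟩

theorem mem_dyadic_iff_floor (n k : ℕ) (x : ℝ) :
    x ∈ Ico (-Real.pi + 2 * Real.pi * k / 2 ^ n) (-Real.pi + 2 * Real.pi * (k + 1) / 2 ^ n) ↔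
      ⌊(x + Real.pi) / (2 * Real.pi) * 2 ^ n⌋ = (k : ℤ) := by
  have hpi := Real.pi_pos
  have h2 : (0 : ℝ) < 2 ^ n := by positivity
  have e1 : ∀ c : ℝ, -Real.pi + 2 * Real.pi * c / 2 ^ n ≤ x ↔
      c ≤ (x + Real.pi) / (2 * Real.pi) * 2 ^ n := fun c => by
    rw [div_mul_eq_mul_div, le_div_iff₀ (by positivity), neg_add_le_iff_le_add,
      div_le_iff₀ h2]
    constructor <;> intro h <;> linarith
  rw [mem_Ico, Int.floor_eq_iff, ← not_le, e1, e1, not_le]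
  push_cast
  rfl

theorem dyadic_subset_of_le {n m k l : ℕ} (hnm : n ≤ m) {x : ℝ}
    (hx : x ∈ Ico (-Real.pi + 2 * Real.pi * k / 2 ^ n) (-Real.pi + 2 * Real.pi * (k + 1) / 2 ^ n))
    (hx' : x ∈ Ico (-Real.pi + 2 * Real.pi * l / 2 ^ m)
      (-Real.pi + 2 * Real.pi * (l + 1) / 2 ^ m)) :
    Ico (-Real.pi + 2 * Real.pi * l / 2 ^ m) (-Real.pi + 2 * Real.pi * (l + 1) / 2 ^ m) ⊆
      Ico (-Real.pi + 2 * Real.pi * k / 2 ^ n) (-Real.pi + 2 * Real.pi * (k + 1) / 2 ^ n) := by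
  intro y hy
  rw [mem_dyadic_iff_floor] at *
  -- The index of the finer dyadic interval determines that of the coarser one by integer division.
  have key : ∀ X : ℝ, ⌊X * 2 ^ n⌋ = ⌊X * 2 ^ m⌋ / ((2 ^ (m - n) : ℕ) : ℤ) := fun X => by
    rw [← Int.floor_div_natCast]
    congr 1
    push_cast
    rw [mul_div_assoc, pow_sub₀ _ two_ne_zero hnm]
    field_simp
  rw [key, hy, ← hx', ← key, hx]

theorem dyadic_nested {A B : Set ℝ} (hA : A ∈ dyadicIntervals) (hB : B ∈ dyadicIntervals)
    (h : ¬Disjoint A B) : A ⊆ B ∨ B ⊆ A := by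
  obtain ⟨n, k, -, rfl⟩ := hA
  obtain ⟨m, l, -, rfl⟩ := hB
  obtain ⟨x, hx, hx'⟩ := not_disjoint_iff.1 h
  rcases le_total n m with hnm | hnm
  · exact Or.inr (dyadic_subset_of_le hnm hx hx')
  · exact Or.inl (dyadic_subset_of_le hnm hx' hx)

theorem pairwiseDisjoint_czFamily (f : ℝ → ℂ) (lam : ℝ) :
    (czFamily f lam).PairwiseDisjoint id := by
  have key : ∀ A ∈ czFamily f lam, ∀ B ∈ czFamily f lam, A ≠ B → ¬A ⊆ B := fun A hA B hB hne h =>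
    (hB.2.1.trans_le (hA.2.2 B hB.1 (h.ssubset_of_ne hne))).false
  intro A hA B hB hne
  by_contra h
  rcases dyadic_nested hA.1 hB.1 h with h | h
  · exact key A hA B hB hne h
  · exact key B hB A hA hne.symm h

theorem countable_czFamily (f : ℝ → ℂ) (lam : ℝ) : (czFamily f lam).Countable :=
  countable_dyadicIntervals.mono fun _ h => h.1

/-- Each selected interval satisfies `λ |I| < ∫_I |f|`, and by maximality the intervals are
disjoint. -/
theorem tsum_volume_czFamily_le {f : ℝ → ℂ} (hf : IntegrableOn f torus) {lam : ℝ}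
    (hlam : 0 < lam) :
    ∑' A : czFamily f lam, volume (A : Set ℝ) ≤ ENNReal.ofReal (normL1 f / lam) := by
  have : Countable (czFamily f lam) := (countable_czFamily f lam).to_subtype
  have hle : ∀ A : czFamily f lam, volume (A : Set ℝ) ≤
      ENNReal.ofReal lam⁻¹ * ∫⁻ x in A, ‖f x‖ₑ := by
    rintro ⟨A, hA, hmean, -⟩
    have hAT := subset_torus_of_mem_dyadicIntervals hA
    obtain ⟨a, h, hh, -, rfl⟩ := exists_eq_Ico_of_mem_dyadicIntervals hA
    rw [meanAbs, volume_real_Ico_add hh, inv_mul_eq_div, lt_div_iff₀ hh] at hmean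
    rw [← ofReal_integral_norm_eq_lintegral_enorm (hf.mono_set hAT),
      ← ENNReal.ofReal_mul (by positivity), Real.volume_Ico]
    apply ENNReal.ofReal_le_ofReal
    rw [inv_mul_eq_div, le_div_iff₀ hlam]
    linarith
  have hd : Pairwise (Function.onFun Disjoint fun A : czFamily f lam => (A : Set ℝ)) := fun A B hne =>
    pairwiseDisjoint_czFamily f lam A.2 B.2 fun h => hne (Subtype.ext h)
  calc ∑' A : czFamily f lam, volume (A : Set ℝ)
      ≤ ∑' A : czFamily f lam, ENNReal.ofReal lam⁻¹ * ∫⁻ x in A, ‖f x‖ₑ := ENNReal.tsum_le_tsum hle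
    _ = ENNReal.ofReal lam⁻¹ * ∫⁻ x in ⋃ A : czFamily f lam, (A : Set ℝ), ‖f x‖ₑ := by
        rw [ENNReal.tsum_mul_left, lintegral_iUnion
          (fun A => measurableSet_of_mem_dyadicIntervals A.2.1) hd]
    _ ≤ ENNReal.ofReal lam⁻¹ * ∫⁻ x in torus, ‖f x‖ₑ := by
        gcongr
        exact iUnion_subset fun A => subset_torus_of_mem_dyadicIntervals A.2.1
    _ = ENNReal.ofReal (normL1 f / lam) := by
        rw [lintegral_enorm_eq_normL1 hf, ← ENNReal.ofReal_mul (by positivity), inv_mul_eq_div]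

theorem neighbour_Ico {a h : ℝ} (hh : 0 < h) (i : ℤ) :
    neighbour (Ico a (a + h)) i = torus ∩
      ⋃ k : ℤ, Ico (a + h * i + 2 * Real.pi * k) (a + h * i + 2 * Real.pi * k + h) := by
  ext x
  simp only [neighbour, volume_real_Ico_add hh, mem_ofPred_eq, mem_inter_iff, mem_iUnion, mem_Ico]
  refine and_congr_right fun _ => ⟨?_, ?_⟩
  · rintro ⟨t, ⟨h1, h2⟩, k, rfl⟩
    exact ⟨k, by linarith, by linarith⟩
  · rintro ⟨k, h1, h2⟩
    exact ⟨x - h * i - 2 * Real.pi * k, ⟨by linarith, by linarith⟩, k, by ring⟩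

theorem volume_neighbour_le {a h : ℝ} (hh : 0 < h) (hh2 : h ≤ 2 * Real.pi) (i : ℤ) :
    volume (neighbour (Ico a (a + h)) i) ≤ 2 * volume (Ico a (a + h)) := by
  have hpi := Real.pi_pos
  set b := a + h * i with hb
  -- The largest `k` for which the translate can start at or below `π`. As the length is at most
  -- `2π`, only `k₀` and `k₀ - 1` can meet the torus, whence the factor `2`.
  set k₀ : ℤ := ⌊(Real.pi - b) / (2 * Real.pi)⌋ with hk₀
  have hsub : neighbour (Ico a (a + h)) i ⊆
      Ico (b + 2 * Real.pi * k₀) (b + 2 * Real.pi * k₀ + h) ∪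
      Ico (b + 2 * Real.pi * (k₀ - 1)) (b + 2 * Real.pi * (k₀ - 1) + h) := by
    rw [neighbour_Ico hh]
    rintro x ⟨⟨hx1, hx2⟩, hx⟩
    obtain ⟨k, hk⟩ := mem_iUnion.1 hx
    rw [← hb] at hk
    obtain ⟨hk1, hk2⟩ := hk
    have h1 : k ≤ k₀ := by
      rw [hk₀, Int.le_floor, le_div_iff₀ (by positivity)]; linarith
    have h2 : k₀ < k + 2 := by
      rw [hk₀, Int.floor_lt, div_lt_iff₀ (by positivity)]; push_cast; linarith
    have h3 : k = k₀ ∨ k = k₀ - 1 := by omega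
    rcases h3 with rfl | rfl
    · exact Or.inl ⟨hk1, hk2⟩
    · push_cast at hk1 hk2; exact Or.inr ⟨hk1, hk2⟩
  refine (measure_mono hsub).trans ((measure_union_le _ _).trans_eq ?_)
  simp only [Real.volume_Ico, add_sub_cancel_left, two_mul]

theorem volume_dilate_le (γ : ℕ) {A : Set ℝ} (hA : A ∈ dyadicIntervals) :
    volume (dilate γ A) ≤ (2 * γ + 1 : ℕ) * (2 * volume A) := by
  obtain ⟨a, h, hh, hh2, rfl⟩ := exists_eq_Ico_of_mem_dyadicIntervals hA
  -- The range `|i| ≤ γ` is larger than necessary; only a constant depending on `γ` matters.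
  have hsub : dilate γ (Ico a (a + h)) ⊆
      ⋃ i ∈ Finset.Icc (-(γ : ℤ)) γ, neighbour (Ico a (a + h)) i := by
    refine iUnion_mono fun i => iUnion_subset fun hi => ?_
    refine subset_iUnion_of_subset ?_ subset_rfl
    rw [Finset.mem_Icc, ← abs_le]
    have := abs_nonneg i
    omega
  refine (measure_mono hsub).trans ((measure_biUnion_finset_le _ _).trans ?_)
  refine (Finset.sum_le_card_nsmul _ _ _ fun i _ => volume_neighbour_le hh hh2 i).trans_eq ?_
  rw [Int.card_Icc, nsmul_eq_mul]
  congr 2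
  omega

theorem measurableSet_dilate (γ : ℕ) {A : Set ℝ} (hA : A ∈ dyadicIntervals) :
    MeasurableSet (dilate γ A) := by
  obtain ⟨a, h, hh, -, rfl⟩ := exists_eq_Ico_of_mem_dyadicIntervals hA
  refine MeasurableSet.iUnion fun i => MeasurableSet.iUnion fun _ => ?_
  rw [neighbour_Ico hh]
  exact measurableSet_torus.inter (MeasurableSet.iUnion fun _ => measurableSet_Ico)

theorem measurableSet_dilatedUnion (γ : ℕ) (f : ℝ → ℂ) (lam ε : ℝ) :
    MeasurableSet (dilatedUnion γ f lam ε) :=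
  MeasurableSet.biUnion ((countable_czFamily f lam).mono fun _ h => h.1)
    fun _ h => measurableSet_dilate γ h.1.1

theorem dilatedUnion_subset_torus (γ : ℕ) (f : ℝ → ℂ) (lam ε : ℝ) :
    dilatedUnion γ f lam ε ⊆ torus :=
  iUnion₂_subset fun _ _ => iUnion₂_subset fun _ _ _ h => h.1

theorem volume_dilatedUnion_le (γ : ℕ) {f : ℝ → ℂ} (hf : IntegrableOn f torus) {lam : ℝ}
    (hlam : 0 < lam) (ε : ℝ) :
    volume (dilatedUnion γ f lam ε) ≤ ENNReal.ofReal ((4 * γ + 2) * (normL1 f / lam)) := by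
  have : Countable (czFamily f lam) := (countable_czFamily f lam).to_subtype
  have hsub : dilatedUnion γ f lam ε ⊆ ⋃ A : czFamily f lam, dilate γ (A : Set ℝ) :=
    iUnion₂_subset fun A hA => subset_iUnion_of_subset ⟨A, hA.1⟩ subset_rfl
  refine (measure_mono hsub).trans ((measure_iUnion_le _).trans ?_)
  refine (ENNReal.tsum_le_tsum fun A => volume_dilate_le γ A.2.1).trans ?_
  rw [ENNReal.tsum_mul_left, ENNReal.tsum_mul_left, ← mul_assoc,
    ENNReal.ofReal_mul (by positivity)]
  gcongr
  · rw [← ENNReal.ofReal_natCast, ← ENNReal.ofReal_ofNat, ← ENNReal.ofReal_mul (by positivity)]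
    apply ENNReal.ofReal_le_ofReal
    push_cast; linarith
  · exact tsum_volume_czFamily_le hf hlam

/-- A move by less than `|A|` leads from a neighbour to itself or to an adjacent one, and `γ + 2`
admits one more neighbour on each side. Hence a point off `(γ + 2) A` keeps distance at least `|A|`
from `γ A`. -/
theorem mem_dilate_of_dist_lt {γ : ℕ} {A : Set ℝ} (hA : A ∈ dyadicIntervals) {y t : ℝ}
    (hy : y ∈ torus) (ht : t ∈ dilate γ A) {k : ℤ}
    (hk : |y - t - 2 * Real.pi * k| < volume.real A) : y ∈ dilate (γ + 2) A := by
  obtain ⟨a, h, hh, -, rfl⟩ := exists_eq_Ico_of_mem_dyadicIntervals hA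
  rw [volume_real_Ico_add hh, abs_lt] at hk
  simp only [dilate, mem_iUnion, exists_prop] at ht ⊢
  obtain ⟨i, hi, ht⟩ := ht
  simp only [neighbour_Ico hh, mem_inter_iff, mem_iUnion, mem_Ico] at ht ⊢
  obtain ⟨-, l, hl⟩ := ht
  have hsum : ∀ j : ℤ, |j| ≤ 1 → 2 * |i + j| + 1 ≤ ((γ + 2 : ℕ) : ℤ) := fun j hj => by
    have := abs_add_le i j
    push_cast; omega
  rcases lt_or_ge y (a + h * i + 2 * Real.pi * (l + k)) with h1 | h1
  · refine ⟨i + -1, hsum _ (by norm_num), hy, l + k, ?_, ?_⟩ <;> push_cast <;> linarith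
  rcases lt_or_ge y (a + h * i + 2 * Real.pi * (l + k) + h) with h2 | h2
  · refine ⟨i + 0, hsum _ (by norm_num), hy, l + k, ?_, ?_⟩ <;> push_cast <;> linarith
  · refine ⟨i + 1, hsum _ (by norm_num), hy, l + k, ?_, ?_⟩ <;> push_cast <;> linarith

/-- Off the dilates `(γ + 2) I` the Fejér mean of the characteristic function of the complement
of `γ F_ε` is close to `1`. -/
theorem norm_fejer_indicator_dilatedUnion_sub_one_le (γ : ℕ) (f : ℝ → ℂ) (lam : ℝ) {ε : ℝ}
    (hε : 0 < ε) (m : ℕ) {y : ℝ} (hy : y ∈ torus) (hy' : y ∉ dilatedUnion (γ + 2) f lam 0) :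
    ‖fejer m (indicator (torus \ dilatedUnion γ f lam ε) fun _ => (1 : ℂ)) y - 1‖ ≤
      16 * Real.pi / ((m + 1) * ε) := by
  have hpi := Real.pi_pos
  have hE := measurableSet_dilatedUnion γ f lam ε
  have hET := dilatedUnion_subset_torus γ f lam ε
  refine (norm_fejer_indicator_compl_sub_one_le m hE hET y).trans ?_
  -- No dyadic interval is longer than `2π`, so for `ε ≥ 2π` the set is empty; otherwise `ε / (2π) <
  -- 1` is an admissible chord length.
  rcases le_or_gt (2 * Real.pi) ε with h2 | h2
  · have : dilatedUnion γ f lam ε = ∅ := by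
      rw [eq_empty_iff_forall_notMem]
      intro t ht
      simp only [dilatedUnion, mem_iUnion, exists_prop, mem_ofPred_eq] at ht
      obtain ⟨A, ⟨hA, hAε⟩, -⟩ := ht
      obtain ⟨a, h, hh, hh2, rfl⟩ := exists_eq_Ico_of_mem_dyadicIntervals hA.1
      rw [volume_real_Ico_add hh] at hAε
      linarith
    rw [this]
    simp only [setIntegral_empty, mul_zero]
    positivity
  have key := setIntegral_fejerKernel_le m (c := ε / (2 * Real.pi)) (y := y) (by positivity)
    (by rwa [div_lt_one (by positivity)]) hE hET fun t ht => ?_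
  · calc 1 / (2 * Real.pi) * ∫ t in dilatedUnion γ f lam ε, fejerKernel m (y - t)
        ≤ 1 / (2 * Real.pi) * (16 * Real.pi / ((m + 1) * (ε / (2 * Real.pi)))) := by gcongr
      _ = 16 * Real.pi / ((m + 1) * ε) := by field_simp
  · refine le_trans ?_ (chord_ge (ε := ε) fun k => ?_)
    · rw [div_mul_eq_mul_div, div_le_div_iff₀ (by positivity) hpi]
      nlinarith [mul_pos hε hpi]
    · by_contra! hlt
      apply hy'
      simp only [dilatedUnion, mem_iUnion, exists_prop, mem_ofPred_eq] at ht ⊢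
      obtain ⟨A, ⟨hA, hAε⟩, ht⟩ := ht
      exact ⟨A, ⟨hA, hε.trans hAε⟩, mem_dilate_of_dist_lt hA.1 hy ht (hlt.trans hAε)⟩

/-! ### The cutoff factors off the exceptional set -/

theorem quarter_le_log_sq {x : ℝ} (hx : 2 ≤ x) : 1 / 4 ≤ Real.log x ^ 2 := by
  have h1 := Real.log_two_gt_d9
  have h2 := Real.log_le_log two_pos hx
  nlinarith

theorem blockLength_pos {δ : ℝ} (hδ : 0 < δ) {N : ℕ} (hN : 1 ≤ N) : 0 < blockLength δ N := by
  have hK : 1 ≤ Nat.sqrt N := Nat.le_sqrt.2 (by simpa using hN)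
  exact Nat.floor_pos.2 (Real.one_le_rpow (by exact_mod_cast hK) (by positivity))

theorem blockLength_le_sqrt {δ : ℝ} (hδ : δ < 1 / 2) {N : ℕ} (hN : 1 ≤ N) :
    (blockLength δ N : ℝ) ≤ Real.sqrt N := by
  have hK : (1 : ℝ) ≤ (Nat.sqrt N : ℕ) := by
    exact_mod_cast Nat.le_sqrt.2 (by simpa using hN)
  calc (blockLength δ N : ℝ) ≤ ((Nat.sqrt N : ℕ) : ℝ) ^ (2 * δ) := Nat.floor_le (by positivity)
    _ ≤ ((Nat.sqrt N : ℕ) : ℝ) ^ (1 : ℝ) := Real.rpow_le_rpow_of_exponent_le hK (by linarith)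
    _ = (Nat.sqrt N : ℕ) := Real.rpow_one _
    _ ≤ Real.sqrt N := Real.nat_sqrt_le_real_sqrt

/-- In `(m_i + 1) β'_i` the frequency `n_i` cancels, leaving a multiple of the block index `j + 1`.
The block length is at most `√N`, so `j ≥ i / √N`. -/
theorem norm_cutoff_sub_one_le {δ : ℝ} (hδ0 : 0 < δ) (hδ : δ < 1 / 2) (n : ℕ → ℕ) (β : ℕ)
    (f : ℝ → ℂ) (lam : ℝ) {N i : ℕ} (hN : 1 ≤ N) (hi : 1 ≤ i) (hn : 1 ≤ n i) {y : ℝ}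
    (hy : y ∈ torus) (hy' : y ∉ dilatedUnion (β + 2) f lam 0) :
    ‖cutoff n δ β f lam N i y - 1‖ ≤ 128 * (Real.sqrt N / i) := by
  have hpi := Real.pi_pos
  have hL := blockLength_pos hδ0 hN
  have hL' := blockLength_le_sqrt hδ hN
  set j := blockIndex δ N i with hj
  have hj1 : (1 : ℝ) ≤ j := by exact_mod_cast Nat.le_add_left 1 _
  have hlog := quarter_le_log_sq (x := (j : ℝ) + 1) (by linarith)
  have hn' : (0 : ℝ) < n i := by exact_mod_cast hn
  have hi' : (0 : ℝ) < i := by exact_mod_cast hi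
  have hthr : 0 < threshold n δ N i := by
    rw [threshold, ← hj]
    have : 0 < Real.log ((j : ℝ) + 1) ^ 2 := by linarith
    positivity
  refine (norm_fejer_indicator_dilatedUnion_sub_one_le β f lam hthr (n i / 10) hy hy').trans ?_
  have hm : (n i : ℝ) / 10 ≤ ((n i / 10 : ℕ) : ℝ) + 1 := by
    have : n i ≤ 10 * (n i / 10 + 1) := by omega
    have : (n i : ℝ) ≤ 10 * (((n i / 10 : ℕ) : ℝ) + 1) := by exact_mod_cast this
    linarith
  have hjL : (i : ℝ) ≤ blockLength δ N * j := by
    have h1 := Nat.div_add_mod i (blockLength δ N)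
    have h2 := Nat.mod_lt i hL
    have : i ≤ blockLength δ N * j := by
      rw [hj, blockIndex, mul_add]; omega
    exact_mod_cast this
  -- The squared logarithm is only used through its lower bound `1/4`; the constant is `20 · (1/4) /
  -- 10 = 1/2`.
  have hden : ((j : ℝ) + 1) / 2 ≤ (((n i / 10 : ℕ) : ℝ) + 1) * threshold n δ N i := by
    calc ((j : ℝ) + 1) / 2 = (n i : ℝ) / 10 * (20 * (j + 1) * (1 / 4) / n i) := by
          field_simp; norm_num
      _ ≤ (((n i / 10 : ℕ) : ℝ) + 1) * threshold n δ N i := by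
          rw [threshold, ← hj]; gcongr
  calc 16 * Real.pi / ((((n i / 10 : ℕ) : ℝ) + 1) * threshold n δ N i)
      ≤ 16 * 4 / (((j : ℝ) + 1) / 2) := by
        gcongr; exact Real.pi_le_four
    _ = 128 / ((j : ℝ) + 1) := by field_simp; norm_num
    _ ≤ 128 * (Real.sqrt N / i) := by
        rw [div_le_iff₀ (by positivity), mul_assoc, div_mul_eq_mul_div]
        refine le_mul_of_one_le_right (by norm_num) ?_
        rw [one_le_div hi']
        refine hjL.trans ?_
        gcongr
        linarith

/-- Off the dilates of the Calderón–Zygmund intervals the difference of the two averages is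
controlled by a fixed weighted sum, for all `N` at once. -/
theorem enorm_modifiedAverage_sub_average_le {δ : ℝ} (hδ0 : 0 < δ) (hδ : δ < 1 / 2) {n : ℕ → ℕ}
    (hn : ∀ i, 1 ≤ i → 1 ≤ n i) (β : ℕ) (f : ℝ → ℂ) (lam : ℝ) {N : ℕ} (hN : 1 ≤ N) {y : ℝ}
    (hy : y ∈ torus) (hy' : y ∉ dilatedUnion (β + 2) f lam 0) :
    ‖modifiedAverage n δ β f lam N y - average n f N y‖ₑ ≤
      ∑ i ∈ Finset.Icc 1 N, ENNReal.ofReal (128 * (i : ℝ) ^ (-(3 / 2) : ℝ)) *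
        ‖partialSum (n i) f y - valleePoussin (n i) f y‖ₑ := by
  have hN' : (0 : ℝ) < N := by exact_mod_cast hN
  have h1 : modifiedAverage n δ β f lam N y - average n f N y = ∑ i ∈ Finset.Icc 1 N,
      (1 / (N : ℂ)) * (cutoff n δ β f lam N i y - 1) *
        (partialSum (n i) f y - valleePoussin (n i) f y) := by
    rw [modifiedAverage, average, ← mul_sub, ← Finset.sum_sub_distrib, Finset.mul_sum]
    exact Finset.sum_congr rfl fun i _ => by ring
  rw [h1]
  refine (enorm_sum_le _ _).trans (Finset.sum_le_sum fun i hi => ?_)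
  obtain ⟨hi1, hiN⟩ := Finset.mem_Icc.1 hi
  have hi' : (0 : ℝ) < i := by exact_mod_cast hi1
  have hiN' : (i : ℝ) ≤ N := by exact_mod_cast hiN
  rw [enorm_mul]
  gcongr
  rw [← ofReal_norm]
  apply ENNReal.ofReal_le_ofReal
  have hc := norm_cutoff_sub_one_le hδ0 hδ n β f lam hN hi1 (hn i hi1) hy hy'
  have hs : Real.sqrt N * Real.sqrt N = N := Real.mul_self_sqrt hN'.le
  have hs0 : 0 < Real.sqrt i := Real.sqrt_pos.2 hi'
  have hsN : Real.sqrt i ≤ Real.sqrt N := Real.sqrt_le_sqrt hiN'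
  have hpow : (i : ℝ) ^ (-(3 / 2) : ℝ) = 1 / (Real.sqrt i * i) := by
    rw [Real.rpow_neg hi'.le, show (3 / 2 : ℝ) = 1 / 2 + 1 by norm_num, Real.rpow_add hi',
      Real.rpow_one, ← Real.sqrt_eq_rpow, one_div]
  rw [norm_mul, norm_div, norm_one, norm_natCast, hpow]
  calc 1 / (N : ℝ) * ‖cutoff n δ β f lam N i y - 1‖
      ≤ 1 / (N : ℝ) * (128 * (Real.sqrt N / i)) := by gcongr
    _ = 128 * (1 / (Real.sqrt N * i)) := by
        nth_rewrite 1 [← hs]; field_simp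
    _ ≤ 128 * (1 / (Real.sqrt i * i)) := by gcongr

/-! ### The weak type estimate -/

theorem summable_nat_rpow_neg_nine_eighths :
    Summable fun i : ℕ => (128 : ℝ) ^ (3 / 4 : ℝ) * (i : ℝ) ^ (-(9 / 8) : ℝ) :=
  (Real.summable_nat_rpow.2 (by norm_num)).mul_left _

theorem sqrt_bound_of_le {x : ℝ} (hx0 : 0 ≤ x) (hx : x ≤ 2 * Real.pi) {a b : ℝ} (ha : 0 ≤ a)
    (hb : 0 ≤ b) : a * x + b * x ^ (3 / 4 : ℝ) ≤ (8 * a + 8 * b) * Real.sqrt x := by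
  have h8 : x ≤ 8 := by linarith [Real.pi_le_four]
  have hs : Real.sqrt x * Real.sqrt x = x := Real.mul_self_sqrt hx0
  have hs8 : Real.sqrt x ≤ 8 := by
    rw [Real.sqrt_le_left (by norm_num)]; linarith
  have h1 : x ≤ 8 * Real.sqrt x := by nlinarith [Real.sqrt_nonneg x]
  have h2 : x ^ (3 / 4 : ℝ) ≤ 8 * Real.sqrt x := by
    rw [show (3 / 4 : ℝ) = 1 / 4 + 1 / 2 by norm_num, Real.rpow_add_of_nonneg hx0 (by norm_num)
      (by norm_num), ← Real.sqrt_eq_rpow]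
    gcongr
    calc x ^ (1 / 4 : ℝ) ≤ 8 ^ (1 / 4 : ℝ) := by gcongr
      _ ≤ 8 ^ (1 : ℝ) := Real.rpow_le_rpow_of_exponent_le (by norm_num) (by norm_num)
      _ = 8 := Real.rpow_one _
  nlinarith

end FourierMeans

end

open FourierMeans

theorem mainTheorem4 (β : ℕ) (hβ : 7 < β) (hβodd : Odd β) :
    ∃ C : ℝ, 0 < C ∧
      ∀ (δ : ℝ), 0 < δ → δ < 1 / 2 →
      ∀ (f : ℝ → ℂ), IntegrableOn f FourierMeans.torus volume →
      ∀ (lam : ℝ), FourierMeans.normL1 f / (2 * Real.pi) < lam →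
      ∀ (n : ℕ → ℕ), (∀ i, 1 ≤ i → 1 ≤ n i) → StrictMonoOn n (Set.Ici 1) →
        volume {y : ℝ | y ∈ FourierMeans.torus ∧
            ENNReal.ofReal (lam / 2) <
              ⨆ (N : ℕ) (_ : 1 ≤ N),
                ‖FourierMeans.modifiedAverage n δ β f lam N y -
                  FourierMeans.average n f N y‖ₑ}
          ≤ ENNReal.ofReal (C * (1 / (1 - 2 * δ)) * Real.sqrt (FourierMeans.normL1 f / lam)) := by
  have hpi := Real.pi_pos
  -- The exponent must satisfy `p < 1` for Kolmogorov's inequality, `3p/2 > 1` for the weights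
  -- `i^{-3p/2}` to be summable, and `p ≥ 1/2` for the final comparison with the square root.
  obtain ⟨C₁, hC₁, hK⟩ := exists_lintegral_partialSum_sub_valleePoussin_le
    (p := 3 / 4) (by norm_num) (by norm_num)
  set w : ℕ → ℝ := fun i => (128 : ℝ) ^ (3 / 4 : ℝ) * (i : ℝ) ^ (-(9 / 8) : ℝ) with hw
  have hw0 : ∀ i, 0 ≤ w i := fun i => by positivity
  set W := ∑' i, w i with hW
  have hW0 : 0 ≤ W := tsum_nonneg hw0
  set a : ℝ := 4 * (β + 2 : ℕ) + 2 with ha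
  set b : ℝ := 2 ^ (3 / 4 : ℝ) * (W * C₁) with hb
  have ha0 : 0 < a := by positivity
  have hb0 : 0 ≤ b := by positivity
  refine ⟨8 * a + 8 * b, by positivity, fun δ hδ0 hδ f hf lam hlam n hn _ => ?_⟩
  have hM := normL1_nonneg f
  have hlam0 : 0 < lam := lt_of_le_of_lt (by positivity) hlam
  set x := normL1 f / lam with hx
  have hx0 : 0 ≤ x := by positivity
  have hx1 : x ≤ 2 * Real.pi := by
    rw [hx, div_le_iff₀ hlam0]
    rw [div_lt_iff₀ (by positivity)] at hlam
    linarith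
  -- The majorant common to all `N`. The last factor removes `i = 0`, where nothing is known about
  -- `n 0`.
  set G : ℝ → ENNReal := fun y => ∑' i : ℕ, ENNReal.ofReal (w i) *
    ‖partialSum (n i) f y - valleePoussin (n i) f y‖ₑ ^ (3 / 4 : ℝ) *
      (if 1 ≤ i then 1 else 0) with hG
  have hmeas : ∀ i : ℕ, Measurable fun y : ℝ =>
      ‖partialSum (n i) f y - valleePoussin (n i) f y‖ₑ ^ (3 / 4 : ℝ) := fun i =>
    ((continuous_partialSum _ f).sub (continuous_valleePoussin _ f)).measurable.enorm.pow_const _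
  have hGmeas : Measurable G :=
    Measurable.tsum fun i => ((hmeas i).const_mul _).mul_const _
  have hGint : ∫⁻ y in torus, G y ≤ ENNReal.ofReal (W * (C₁ * normL1 f ^ (3 / 4 : ℝ))) := by
    rw [hG, lintegral_tsum fun i => (((hmeas i).const_mul _).mul_const _).aemeasurable,
      ENNReal.ofReal_mul hW0, hW,
      ENNReal.ofReal_tsum_of_nonneg hw0 summable_nat_rpow_neg_nine_eighths, ← ENNReal.tsum_mul_right]
    refine ENNReal.tsum_le_tsum fun i => ?_
    by_cases hi : 1 ≤ i
    · simp only [hi, if_true, mul_one]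
      rw [lintegral_const_mul _ (hmeas i)]
      gcongr
      exact hK f hf (n i) (hn i hi)
    · simp [hi]
  have hsub : {y : ℝ | y ∈ torus ∧ ENNReal.ofReal (lam / 2) < ⨆ (N : ℕ) (_ : 1 ≤ N),
      ‖modifiedAverage n δ β f lam N y - average n f N y‖ₑ} ⊆
      dilatedUnion (β + 2) f lam 0 ∪
        (torus ∩ {y | ENNReal.ofReal ((lam / 2) ^ (3 / 4 : ℝ)) ≤ G y}) := by
    rintro y ⟨hy, hlt⟩
    by_cases hy' : y ∈ dilatedUnion (β + 2) f lam 0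
    · exact Or.inl hy'
    refine Or.inr ⟨hy, ?_⟩
    simp only [lt_iSup_iff] at hlt
    obtain ⟨N, hN, hlt⟩ := hlt
    have h1 := hlt.le.trans
      (enorm_modifiedAverage_sub_average_le hδ0 hδ hn β f lam hN hy hy')
    rw [mem_ofPred_eq, ← ENNReal.ofReal_rpow_of_nonneg (by positivity) (by norm_num)]
    calc ENNReal.ofReal (lam / 2) ^ (3 / 4 : ℝ)
        ≤ (∑ i ∈ Finset.Icc 1 N, ENNReal.ofReal (128 * (i : ℝ) ^ (-(3 / 2) : ℝ)) *
          ‖partialSum (n i) f y - valleePoussin (n i) f y‖ₑ) ^ (3 / 4 : ℝ) := by gcongr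
      _ ≤ ∑ i ∈ Finset.Icc 1 N, (ENNReal.ofReal (128 * (i : ℝ) ^ (-(3 / 2) : ℝ)) *
          ‖partialSum (n i) f y - valleePoussin (n i) f y‖ₑ) ^ (3 / 4 : ℝ) :=
          Finset.le_sum_of_subadditive (fun x : ENNReal => x ^ (3 / 4 : ℝ))
            (by norm_num) (fun x y => ENNReal.rpow_add_le_add_rpow x y (by norm_num) (by norm_num))
            _ _
      _ = ∑ i ∈ Finset.Icc 1 N, ENNReal.ofReal (w i) *
          ‖partialSum (n i) f y - valleePoussin (n i) f y‖ₑ ^ (3 / 4 : ℝ) *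
            (if 1 ≤ i then 1 else 0) := by
          refine Finset.sum_congr rfl fun i hi => ?_
          rw [if_pos (Finset.mem_Icc.1 hi).1, mul_one, ENNReal.mul_rpow_of_nonneg _ _ (by norm_num),
            ENNReal.ofReal_rpow_of_nonneg (by positivity) (by norm_num),
            Real.mul_rpow (by norm_num) (by positivity), ← Real.rpow_mul (by positivity)]
          norm_num [hw]
      _ ≤ G y := ENNReal.sum_le_tsum _
  have hmarkov : volume (torus ∩ {y | ENNReal.ofReal ((lam / 2) ^ (3 / 4 : ℝ)) ≤ G y}) ≤
      ENNReal.ofReal (b * x ^ (3 / 4 : ℝ)) := by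
    have hl : 0 < (lam / 2) ^ (3 / 4 : ℝ) := by positivity
    have h1 := meas_ge_le_lintegral_div (μ := volume.restrict torus) hGmeas.aemeasurable
      (ε := ENNReal.ofReal ((lam / 2) ^ (3 / 4 : ℝ))) (by simpa using hl) ENNReal.ofReal_ne_top
    rw [Measure.restrict_apply (measurableSet_le measurable_const hGmeas), inter_comm] at h1
    refine h1.trans ((ENNReal.div_le_div_right hGint _).trans_eq ?_)
    rw [← ENNReal.ofReal_div_of_pos hl]
    congr 1
    rw [hx, hb, Real.div_rpow hM hlam0.le, Real.div_rpow hlam0.le (by norm_num)]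
    field_simp
  refine (measure_mono hsub).trans ((measure_union_le _ _).trans ?_)
  refine (add_le_add (volume_dilatedUnion_le (β + 2) hf hlam0 0) hmarkov).trans ?_
  rw [← ENNReal.ofReal_add (by positivity) (by positivity)]
  apply ENNReal.ofReal_le_ofReal
  refine (sqrt_bound_of_le hx0 hx1 ha0.le hb0).trans ?_
  -- The estimate obtained so far is uniform in `δ`; this factor only enlarges it.
  have h1 : 1 ≤ 1 / (1 - 2 * δ) := by
    rw [one_le_div (by linarith)]; linarith
  gcongr
  exact le_mul_of_one_le_right (by positivity) h1
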